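/- Let $A=[a_{ij}]$ be a $d\times n$ integer matrix of rank $d$ that is homogeneous (its columns lie on a hyperplane of $\mathbb Q^d$ not passing through the origin), let $\beta\in\mathbb C^d$, put $L=\{u\in\mathbb Z^n : Au=0\}$, and let $I_A=\langle \partial^{a}-\partial^{a'} : a,a'\in\mathbb N^n,\ Aa=Aa'\rangle\subset\mathbb C[\partial_1,\dots,\partial_n]$. An $A$-hypergeometric series is a formal logarithmic series $\phi=\sum_z r_z(\log x)\,x^z$ ($z\in\mathbb C^n$, $r_z\in\mathbb C[y_1,\dots,y_n]$) annihilated by $I_A$ and by the Euler operators $\sum_j a_{ij}x_j\partial_j-\beta_i$ $(1\le i\le d)$. Let $w\in\mathbb R^n$ be a generic weight (i.e. $\mathrm{in}_w(I_A)$ is a monomial ideal), and let $v_0$ be a fake exponent, i.e. $Av_0=\beta$ and $\partial^a\bullet x^{v_0}=0$ for every monomial $\partial^a\in\mathrm{in}_w(I_A)$. For $z\in\mathbb C^n$ let $\mathrm{nsupp}(z)=\{i : z_i\in\mathbb Z_{<0}\}$. Let $v\in v_0+L$ be a minimal $w$-weight vector: $w\cdot u\ge 0$ for all $u\in L$ with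 $\mathrm{nsupp}(v+u)=\mathrm{nsupp}(v)$. Write $I_u=\mathrm{nsupp}(v+u)$ for $u\in L$, $\mathrm{NS}=\{I_u : u\in L\}$, and $$\mathcal N_v=\{I\in\mathrm{NS} : w\cdot u\ge 0\text{ for all }u\in L\text{ with }I_u=I\}.$$ Fix a basis $B=(b^{(1)},\dots,b^{(n-d)})$ of $L$, let $s=(s_1,\dots,s_{n-d})$, $(Bs)_i=\sum_k b^{(k)}_i s_k$, and $(Bs)^I=\prod_{i\in I}(Bs)_i$ for $I\subset\{1,\dots,n\}$. For $\mathcal N\subset\mathrm{NS}$ put $K_{\mathcal N}=\bigcap_{I\in\mathcal N}I$, $m_{v,\mathcal N}=(Bs)^{I_0\setminus K_{\mathcal N}}$, and define ideals of $\mathbb C[[s]]$ by $$P_{\mathcal N}=\langle (Bs)^{(I\cup J)\setminus K_{\mathcal N}} : I\in\mathcal N,\ J\in\mathrm{NS}\setminus\mathcal N\rangle,\qquad P_{B_{\mathcal N}}=\langle (Bs)^{J\setminus I_0} : J\in\mathrm{NS}\setminus\mathcal N\rangle .$$ Let $P_{\mathcal N}^\perp=\{q\in\mathbb C[\partial_s]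 : (q(\partial_s)\bullet p)|_{s=0}=0\text{ for all }p\in P_{\mathcal N}\}$, and put $$\widetilde F_{v,\mathcal N}(x,s)=m_{v,\mathcal N}(s)\sum_{u\in L,\ I_u\in\mathcal N}a_u(s)\,x^{v+Bs+u},\qquad a_u(s)=\frac{[v+Bs]_{u_-}}{[v+Bs+u]_{u_+}},$$ where $u=u_+-u_-$ with $u_\pm=\max(\pm u,0)$ and $[z]_a=\prod_i z_i(z_i-1)\cdots(z_i-a_i+1)$. A series is supported in $\mathcal N$ if it involves only exponents $v+u$ with $u\in L$, $I_u\in\mathcal N$. It has exponent $v$ if $x^v$ occurs in it and $w\cdot u\ge0$ for every $u\in L$ such that $x^{v+u}$ occurs in it. Suppose that $I_0\in\mathcal N'\subset\mathcal N''\subset\mathcal N_v$ and $P_{\mathcal N''}:m_{v,\mathcal N''}=P_{B_{\mathcal N''}}$. Then, at the exponent $v$, every $A$-hypergeometric series $\phi$ supported in $\mathcal N'$ with exponent $v$ is obtained from series supported in $\mathcal N''$ by perturbation inside $L$: there is a $q\in P_{\mathcal N''}^\perp$ such that $$\psi=\bigl(q(\partial_s)\bullet\widetilde F_{v,\mathcal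 N''}(x,s)\bigr)\big|_{s=0}$$ is an $A$-hypergeometric series supported in $\mathcal N''$, has exponent $v$, and has the same coefficient of $x^v$ (a polynomial in $\log x$) as $\phi$. -/

import Mathlib

open scoped BigOperators

noncomputable section

namespace AHyp

/-! ### The lattice, negative supports, the toric ideal -/

/-- `L = Ker_ℤ A`. -/
def lattice {d n : ℕ} (A : Matrix (Fin d) (Fin n) ℤ) : Submodule ℤ (Fin n → ℤ) :=
  LinearMap.ker A.mulVecLin

/-- The vector `v + u` for `v ∈ ℂⁿ` and `u ∈ ℤⁿ`. -/
def shift {n : ℕ} (v : Fin n → ℂ) (u : Fin n → ℤ) : Fin n → ℂ :=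
  fun i => v i + (u i : ℂ)

open Classical in
/-- The negative support: the set of `i` such that `v i` is a negative integer. -/
def nsupp {n : ℕ} (v : Fin n → ℂ) : Finset (Fin n) :=
  Finset.univ.filter fun i => ∃ m : ℤ, m < 0 ∧ v i = (m : ℂ)

theorem mem_nsupp {n : ℕ} (v : Fin n → ℂ) (i : Fin n) :
    i ∈ nsupp v ↔ ∃ m : ℤ, m < 0 ∧ v i = (m : ℂ) := by
  simp [nsupp]

/-- `A` is homogeneous: its columns lie on a hyperplane of `ℚ^d` that misses the origin. -/
def IsHomogeneousMatrix {d n : ℕ} (A : Matrix (Fin d) (Fin n) ℤ) : Prop :=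
  ∃ c : Fin d → ℚ, ∀ j, ∑ i, c i * (A i j : ℚ) = 1

/-- The toric ideal `I_A` in `ℂ[∂₁, …, ∂ₙ]`. -/
def toricIdeal {d n : ℕ} (A : Matrix (Fin d) (Fin n) ℤ) : Ideal (MvPolynomial (Fin n) ℂ) :=
  Ideal.span {p | ∃ a a' : Fin n →₀ ℕ,
    (∀ i, ∑ j, A i j * (a j : ℤ) = ∑ j, A i j * (a' j : ℤ)) ∧
    p = MvPolynomial.monomial a 1 - MvPolynomial.monomial a' 1}

/-- `w · u` for an integer vector `u`. -/
def weight {n : ℕ} (w : Fin n → ℝ) (u : Fin n → ℤ) : ℝ := ∑ i, w i * (u i : ℝ)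

open Classical in
/-- The initial form `in_w(f)`: the sum of the terms of `f` of maximal `w`-weight. -/
def initialForm {n : ℕ} (w : Fin n → ℝ) (f : MvPolynomial (Fin n) ℂ) :
    MvPolynomial (Fin n) ℂ :=
  ∑ a ∈ f.support.filter
      (fun a => ∀ a' ∈ f.support, ∑ i, w i * (a' i : ℝ) ≤ ∑ i, w i * (a i : ℝ)),
    MvPolynomial.monomial a (f.coeff a)

/-- The initial ideal `in_w(I)`. -/
def initialIdeal {n : ℕ} (w : Fin n → ℝ) (I : Ideal (MvPolynomial (Fin n) ℂ)) :
    Ideal (MvPolynomial (Fin n) ℂ) :=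
  Ideal.span (initialForm w '' (I : Set (MvPolynomial (Fin n) ℂ)))

/-- `w` is a generic weight: `in_w(I_A)` is a monomial ideal. -/
def IsGenericWeight {d n : ℕ} (A : Matrix (Fin d) (Fin n) ℤ) (w : Fin n → ℝ) : Prop :=
  ∃ S : Set (Fin n →₀ ℕ), initialIdeal w (toricIdeal A) =
    Ideal.span ((fun a => MvPolynomial.monomial a (1 : ℂ)) '' S)

/-- The falling factorial `[z]_a = ∏ᵢ zᵢ (zᵢ - 1) ⋯ (zᵢ - aᵢ + 1)`. -/
def falling {n : ℕ} {R : Type*} [CommRing R] (z : Fin n → R) (a : Fin n → ℕ) : R :=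
  ∏ i, ∏ k ∈ Finset.range (a i), (z i - (k : R))

/-- `v` is a fake exponent of `H_A(β)` with respect to `w`: `A v = β`, and
`∂^a • x^v = 0` for every monomial `∂^a` of `in_w(I_A)`. -/
def IsFakeExponent {d n : ℕ} (A : Matrix (Fin d) (Fin n) ℤ) (β : Fin d → ℂ) (w : Fin n → ℝ)
    (v : Fin n → ℂ) : Prop :=
  (∀ i, ∑ j, (A i j : ℂ) * v j = β i) ∧
  ∀ a : Fin n →₀ ℕ, MvPolynomial.monomial a (1 : ℂ) ∈ initialIdeal w (toricIdeal A) →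
    falling v a = 0

/-- `NS = {nsupp(v + u) | u ∈ L}`. It depends only on the class `v + L`. -/
def NS {d n : ℕ} (A : Matrix (Fin d) (Fin n) ℤ) (v : Fin n → ℂ) : Set (Finset (Fin n)) :=
  {I | ∃ u ∈ lattice A, nsupp (shift v u) = I}

/-- `v` is a minimal `w`-weight vector: it has the least `w`-weight among the vectors of
`v + L` with the same negative support. -/
def IsMinimalWeight {d n : ℕ} (A : Matrix (Fin d) (Fin n) ℤ) (w : Fin n → ℝ)
    (v : Fin n → ℂ) : Prop :=
  ∀ u ∈ lattice A, nsupp (shift v u) = nsupp v → 0 ≤ weight w u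

/-- `N_v`: the `I ∈ NS` such that `w · u ≥ 0` for all `u ∈ L` with `nsupp(v + u) = I`. -/
def Nv {d n : ℕ} (A : Matrix (Fin d) (Fin n) ℤ) (w : Fin n → ℝ) (v : Fin n → ℂ) :
    Set (Finset (Fin n)) :=
  {I | I ∈ NS A v ∧ ∀ u ∈ lattice A, nsupp (shift v u) = I → 0 ≤ weight w u}

/-! ### Logarithmic series and the hypergeometric system -/

/-- A formal logarithmic series `∑_z r_z(log x) x^z`, given by its coefficients
`z ↦ r_z ∈ ℂ[y₁, …, yₙ]`, where `y_j` stands for `log x_j`. -/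
abbrev LogSeries (n : ℕ) : Type := (Fin n → ℂ) → MvPolynomial (Fin n) ℂ

/-- Multiplication by `x_j`: the coefficient of `x^z` in `x_j φ` is that of `x^(z - e_j)` in
`φ`. -/
def mulX {n : ℕ} (j : Fin n) : Module.End ℂ (LogSeries n) :=
  LinearMap.funLeft ℂ (MvPolynomial (Fin n) ℂ) fun z => z - Pi.single j (1 : ℂ)

/-- The derivation `∂_j = ∂/∂x_j`:
`∂_j (r(log x) x^z) = ((∂_{y_j} + z_j) r)(log x) x^(z - e_j)`. -/
def derivX {n : ℕ} (j : Fin n) : Module.End ℂ (LogSeries n) where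
  toFun := fun φ z => MvPolynomial.pderiv j (φ (z + Pi.single j (1 : ℂ))) +
    (z j + 1) • φ (z + Pi.single j (1 : ℂ))
  map_add' := fun φ ψ => by
    funext z
    simp only [Pi.add_apply, map_add, smul_add]
    abel
  map_smul' := fun c φ => by
    funext z
    simp only [Pi.smul_apply, Derivation.map_smul, smul_add, RingHom.id_apply,
      smul_comm c (z j + 1)]

/-- The operator `∂^a = ∂₁^(a₁) ⋯ ∂ₙ^(aₙ)`. -/
def derivMonomial {n : ℕ} (a : Fin n →₀ ℕ) : Module.End ℂ (LogSeries n) :=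
  ((List.finRange n).map fun j => derivX j ^ a j).prod

/-- The constant-coefficient operator `p(∂)`. -/
def diffOp {n : ℕ} (p : MvPolynomial (Fin n) ℂ) : Module.End ℂ (LogSeries n) :=
  ∑ a ∈ p.support, p.coeff a • derivMonomial a

/-- The Euler operator `∑_j a_{ij} θ_j - β_i`, with `θ_j = x_j ∂_j`. -/
def eulerOp {d n : ℕ} (A : Matrix (Fin d) (Fin n) ℤ) (β : Fin d → ℂ) (i : Fin d) :
    Module.End ℂ (LogSeries n) :=
  (∑ j, (A i j : ℂ) • (mulX j * derivX j)) - β i • 1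

/-- `φ` is an `A`-hypergeometric series with parameter `β`: it is annihilated by `I_A` and by
the Euler operators, hence by the left ideal `H_A(β)` that they generate. -/
def IsHypergeometric {d n : ℕ} (A : Matrix (Fin d) (Fin n) ℤ) (β : Fin d → ℂ)
    (φ : LogSeries n) : Prop :=
  (∀ p ∈ toricIdeal A, diffOp p φ = 0) ∧ ∀ i, eulerOp A β i φ = 0

/-- `φ` is supported in `N`: only exponents `v + u` with `u ∈ L` and `nsupp(v + u) ∈ N` occur. -/
def SupportedIn {d n : ℕ} (A : Matrix (Fin d) (Fin n) ℤ) (v : Fin n → ℂ)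
    (N : Set (Finset (Fin n))) (φ : LogSeries n) : Prop :=
  ∀ z, φ z ≠ 0 → ∃ u ∈ lattice A, z = shift v u ∧ nsupp (shift v u) ∈ N

/-- `φ` (with support in `v + L`) has exponent `v` in direction `w`: `x^v` occurs in `φ`, with
the least `w`-weight among the exponents that occur. -/
def HasExponent {d n : ℕ} (A : Matrix (Fin d) (Fin n) ℤ) (w : Fin n → ℝ) (v : Fin n → ℂ)
    (φ : LogSeries n) : Prop :=
  φ v ≠ 0 ∧ ∀ u ∈ lattice A, φ (shift v u) ≠ 0 → 0 ≤ weight w u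

/-! ### The ideals in `ℂ[[s]]` -/

/-- The linear form `(B s)_i = ∑_k b^(k)_i s_k`, where `B` has the columns `b k`. -/
def linForm {h n : ℕ} (b : Fin h → Fin n → ℤ) (i : Fin n) : MvPowerSeries (Fin h) ℂ :=
  ∑ k, MvPowerSeries.C (b k i : ℂ) * MvPowerSeries.X k

/-- `(B s)^I = ∏_{i ∈ I} (B s)_i`. -/
def linProd {h n : ℕ} (b : Fin h → Fin n → ℤ) (I : Finset (Fin n)) :
    MvPowerSeries (Fin h) ℂ :=
  ∏ i ∈ I, linForm b i

open Classical in
/-- `K_N`, the intersection of all `I ∈ N`. -/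
def KN {n : ℕ} (N : Set (Finset (Fin n))) : Finset (Fin n) :=
  Finset.univ.filter fun i => ∀ I ∈ N, i ∈ I

/-- `m_{v,N}(s) = (B s)^(I₀ \ K_N)` with `I₀ = nsupp(v)`. -/
def mN {h n : ℕ} (b : Fin h → Fin n → ℤ) (v : Fin n → ℂ) (N : Set (Finset (Fin n))) :
    MvPowerSeries (Fin h) ℂ :=
  linProd b (nsupp v \ KN N)

/-- `P_N = ⟨(B s)^((I ∪ J) \ K_N) | I ∈ N, J ∈ NS \ N⟩`. -/
def PN {d h n : ℕ} (A : Matrix (Fin d) (Fin n) ℤ) (b : Fin h → Fin n → ℤ) (v : Fin n → ℂ)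
    (N : Set (Finset (Fin n))) : Ideal (MvPowerSeries (Fin h) ℂ) :=
  Ideal.span {p | ∃ I ∈ N, ∃ J ∈ NS A v \ N, p = linProd b ((I ∪ J) \ KN N)}

/-- `P_{B_N} = ⟨(B s)^(J \ I₀) | J ∈ NS \ N⟩`. -/
def PB {d h n : ℕ} (A : Matrix (Fin d) (Fin n) ℤ) (b : Fin h → Fin n → ℤ) (v : Fin n → ℂ)
    (N : Set (Finset (Fin n))) : Ideal (MvPowerSeries (Fin h) ℂ) :=
  Ideal.span {p | ∃ J ∈ NS A v \ N, p = linProd b (J \ nsupp v)}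

/-! ### Perturbation inside `L` -/

/-- The pairing `(q(∂_s) • F(s))|_{s=0}`, where `(∂_s^α • F)|_{s=0} = α! · coeff_α F`; the
power series `F` may have coefficients in a `ℂ`-algebra `R`. -/
def pairing {h : ℕ} {R : Type*} [CommRing R] [Algebra ℂ R] (q : MvPolynomial (Fin h) ℂ)
    (F : MvPowerSeries (Fin h) R) : R :=
  ∑ α ∈ q.support, (q.coeff α * ((∏ k, (α k).factorial : ℕ) : ℂ)) • MvPowerSeries.coeff α F

/-- `P^⊥ ⊆ ℂ[∂_s]`. -/
def perp {h : ℕ} (P : Ideal (MvPowerSeries (Fin h) ℂ)) : Set (MvPolynomial (Fin h) ℂ) :=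
  {q | ∀ p ∈ P, pairing q p = 0}

/-- `v + B s`. -/
def perturbed {h n : ℕ} (b : Fin h → Fin n → ℤ) (v : Fin n → ℂ) :
    Fin n → MvPowerSeries (Fin h) ℂ :=
  fun i => MvPowerSeries.C (v i) + linForm b i

/-- The power series `m_{v,N}(s) a_u(s)`, where
`a_u(s) = [v + B s]_{u₋} / [v + B s + u]_{u₊}`; it is characterised by clearing the
denominator. -/
def frobCoeff {h n : ℕ} (b : Fin h → Fin n → ℤ) (v : Fin n → ℂ) (N : Set (Finset (Fin n)))
    (u : Fin n → ℤ) : MvPowerSeries (Fin h) ℂ :=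
  Classical.epsilon fun f =>
    f * falling (perturbed b (shift v u)) (fun i => (u i).toNat) =
      mN b v N * falling (perturbed b v) (fun i => (-(u i)).toNat)

/-- `x^(B s) = exp(∑_k s_k (log x · b^(k)))` as a power series in `s` with coefficients in
`ℂ[y]`, `y = log x`. -/
def expForm {h n : ℕ} (b : Fin h → Fin n → ℤ) :
    MvPowerSeries (Fin h) (MvPolynomial (Fin n) ℂ) :=
  fun α => MvPolynomial.C (((∏ k, (α k).factorial : ℕ) : ℂ)⁻¹) *
    ∏ k, (∑ j, MvPolynomial.C (b k j : ℂ) * MvPolynomial.X j) ^ α k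

open Classical in
/-- The series `(q(∂_s) • F̃_{v,N}(x, s))|_{s=0}`, where
`F̃_{v,N}(x, s) = m_{v,N}(s) ∑_{u ∈ L, nsupp(v+u) ∈ N} a_u(s) x^(v + B s + u)`. -/
def frobSeries {d h n : ℕ} (A : Matrix (Fin d) (Fin n) ℤ) (b : Fin h → Fin n → ℤ)
    (v : Fin n → ℂ) (N : Set (Finset (Fin n))) (q : MvPolynomial (Fin h) ℂ) : LogSeries n :=
  fun z =>
    if hz : ∃ u ∈ lattice A, z = shift v u ∧ nsupp (shift v u) ∈ N then
      pairing q (MvPowerSeries.map MvPolynomial.C (frobCoeff b v N hz.choose) * expForm b)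
    else 0

/-! ### `frobCoeff` is well defined -/

theorem exists_frobCoeff {h n : ℕ} (b : Fin h → Fin n → ℤ) (v : Fin n → ℂ)
    (N : Set (Finset (Fin n))) (u : Fin n → ℤ) (hu : nsupp (shift v u) ∈ N) :
    ∃ f, f * falling (perturbed b (shift v u)) (fun i => (u i).toNat) =
      mN b v N * falling (perturbed b v) (fun i => (-(u i)).toNat) := by
  suffices H : falling (perturbed b (shift v u)) (fun i => (u i).toNat) ∣ mN b v N by
    obtain ⟨g, hg⟩ := H
    exact ⟨g * falling (perturbed b v) (fun i => (-(u i)).toNat), by rw [hg]; ring⟩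
  have hm : mN b v N = ∏ i, if i ∈ nsupp v \ KN N then linForm b i else 1 := by
    rw [mN, linProd, Finset.prod_ite_mem, Finset.univ_inter]
  rw [hm, falling]
  refine Finset.prod_dvd_prod_of_dvd _ _ fun i _ => ?_
  have hc : ∀ k : ℕ, MvPowerSeries.constantCoeff (perturbed b (shift v u) i -
      (k : MvPowerSeries (Fin h) ℂ)) = v i + (u i : ℂ) - (k : ℂ) := by
    intro k
    simp [perturbed, linForm, shift]
  have hunit : ∀ k : ℕ, v i + (u i : ℂ) - (k : ℂ) ≠ 0 →
      IsUnit (perturbed b (shift v u) i - (k : MvPowerSeries (Fin h) ℂ)) := by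
    intro k hk
    rw [MvPowerSeries.isUnit_iff_constantCoeff, hc]
    exact isUnit_iff_ne_zero.mpr hk
  by_cases hz : ∃ k ∈ Finset.range (u i).toNat, v i + (u i : ℂ) - (k : ℂ) = 0
  · obtain ⟨k, hk, hk0⟩ := hz
    have hk' : k < (u i).toNat := Finset.mem_range.mp hk
    have hv : v i = (((k : ℤ) - u i : ℤ) : ℂ) := by
      push_cast
      linear_combination hk0
    have h1 : i ∈ nsupp v := (mem_nsupp v i).mpr ⟨(k : ℤ) - u i, by omega, hv⟩
    have h2 : i ∉ nsupp (shift v u) := by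
      rw [mem_nsupp, shift]
      rintro ⟨m, hm0, hm1⟩
      rw [hv] at hm1
      have : ((k : ℤ) - u i) + u i = m := by exact_mod_cast hm1
      omega
    have h3 : i ∈ nsupp v \ KN N := by
      rw [Finset.mem_sdiff]
      refine ⟨h1, fun hK => h2 ?_⟩
      simp only [KN, Finset.mem_filter, Finset.mem_univ, true_and] at hK
      exact hK _ hu
    rw [if_pos h3, ← Finset.mul_prod_erase _ _ hk]
    have h4 : perturbed b (shift v u) i - (k : MvPowerSeries (Fin h) ℂ) = linForm b i := by
      have hC : (k : MvPowerSeries (Fin h) ℂ) = MvPowerSeries.C (k : ℂ) := by simp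
      have hvk : shift v u i = (k : ℂ) := by
        simp only [shift]
        linear_combination hk0
      rw [perturbed, hvk, hC]
      ring
    rw [h4]
    have h5 : IsUnit (∏ x ∈ (Finset.range (u i).toNat).erase k,
        (perturbed b (shift v u) i - (x : MvPowerSeries (Fin h) ℂ))) := by
      refine IsUnit.prod_iff.mpr fun x hx => hunit x fun hx0 => ?_
      refine (Finset.mem_erase.mp hx).1 ?_
      have : (x : ℂ) = (k : ℂ) := by linear_combination hk0 - hx0
      exact_mod_cast this
    obtain ⟨U, hU⟩ := h5
    rw [← hU]
    exact (Units.mul_right_dvd).mpr dvd_rfl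
  · push Not at hz
    have h5 : IsUnit (∏ x ∈ Finset.range (u i).toNat,
        (perturbed b (shift v u) i - (x : MvPowerSeries (Fin h) ℂ))) :=
      IsUnit.prod_iff.mpr fun x hx => hunit x (hz x hx)
    exact h5.dvd

theorem frobCoeff_denominator_ne_zero {h n : ℕ} (b : Fin h → Fin n → ℤ) (v : Fin n → ℂ)
    (u : Fin n → ℤ) (hu : u ∈ Submodule.span ℤ (Set.range b)) :
    falling (perturbed b (shift v u)) (fun i => (u i).toNat) ≠ 0 := by
  classical
  rw [falling]
  refine Finset.prod_ne_zero_iff.mpr fun i _ => Finset.prod_ne_zero_iff.mpr fun k hk => ?_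
  intro h0
  have hl : ∀ l, b l i = 0 := by
    intro l
    have := congrArg (MvPowerSeries.coeff (Finsupp.single l 1)) h0
    have hC : (k : MvPowerSeries (Fin h) ℂ) = MvPowerSeries.C (k : ℂ) := by simp
    rw [hC, perturbed, linForm] at this
    simp only [map_sub, map_add, map_sum, MvPowerSeries.coeff_C_mul, MvPowerSeries.coeff_C,
      MvPowerSeries.coeff_X, map_zero, Finsupp.single_eq_zero, one_ne_zero, if_false,
      Finsupp.single_left_inj one_ne_zero, mul_ite, mul_one, mul_zero, Finset.sum_ite_eq,
      Finset.mem_univ, if_true, zero_add, sub_zero] at this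
    exact_mod_cast this
  have hui : u i = 0 := by
    refine Submodule.span_induction (p := fun x _ => x i = 0) ?_ rfl ?_ ?_ hu
    · rintro _ ⟨l, rfl⟩
      exact hl l
    · intro x y _ _ hx hy
      simp [hx, hy]
    · intro a x _ hx
      simp [hx]
  rw [hui] at hk
  simp at hk

theorem frobCoeff_spec {h n : ℕ} (b : Fin h → Fin n → ℤ) (v : Fin n → ℂ)
    (N : Set (Finset (Fin n))) (u : Fin n → ℤ) (hu : nsupp (shift v u) ∈ N) :
    frobCoeff b v N u * falling (perturbed b (shift v u)) (fun i => (u i).toNat) =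
      mN b v N * falling (perturbed b v) (fun i => (-(u i)).toNat) :=
  Classical.epsilon_spec (exists_frobCoeff b v N u hu)

end AHyp

end

/-!
The coefficient of `x^z` in a series obtained by perturbation inside `L` has the form
`(q(∂_s) • f(s) x^(B s))|_{s=0}`, a polynomial in `y = log x` written `logTerm b q f` below. Since
`∂_{y_j} x^(B s) = (B s)_j x^(B s)`, every operator `∂^a` acts on such a term by multiplying the
symbol `f` by the falling factorial `[p + B s]_a` (`derivMonomial_eq_logTerm`). Up to a unit of
`ℂ[[s]]` this factorial is the product of the `(B s)_i` over those `i` at which the exponent becomes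
a negative integer (`falling_perturbed_associated`).

*Perturbed series are hypergeometric.* For a binomial `∂^a - ∂^(a')` of the toric ideal, the two
terms that meet at an exponent come from `v + u` and `v + u'` with `u - a = u' - a'`. If both are in
the support they cancel by a cocycle identity for falling factorials
(`falling_mul_frobCoeff_eq`); if just one is, its symbol is divisible by a generator of `P_N`
(`falling_mul_frobCoeff_mem_PN`), so that it is killed by `q ∈ P_N^⊥`.

*The coefficient of `x^v` in `φ`.* The Euler operators make it invariant under translation by the
rows of `A`, hence a polynomial `Q` in the forms `b^(k) · y` (`exists_eq_aeval_logForm`). For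
`J = nsupp(v + u)` outside `N''` the coefficient of `φ` at `v + u` vanishes; comparing `∂^(u₋)` and
`∂^(u₊)` gives `[v + B s]_{u₋}(∂) • Q = 0`, that is, `Q` is annihilated by `(B s)^(J \ I₀)`
(`pairing_linProd_mul_eq_zero`). So `Q ∈ P_B^⊥`.

*Lifting.* By hypothesis `P_B = P : m`, and for a homogeneous ideal `P` and a form `m` the inverse
system of `P : m` is the contraction by `m` of that of `P` (`exists_mem_perp_of_colon`). This yields
`q ∈ P^⊥` with `⟨q, m g⟩ = ⟨Q, g⟩` for all `g`. As the symbol of the perturbed series at `x^v` is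
`m`, its coefficient there is that of `φ`.
-/

noncomputable section

namespace AHyp

/-! ### The pairing and contraction -/

/-- The pairing with a fixed `q`, as a linear functional in the power series. -/
def pairingHom {h : ℕ} {R : Type*} [CommRing R] [Algebra ℂ R] (q : MvPolynomial (Fin h) ℂ) :
    MvPowerSeries (Fin h) R →ₗ[R] R where
  toFun := pairing q
  map_add' F G := by
    simp only [pairing, map_add, smul_add, Finset.sum_add_distrib]
  map_smul' c F := by
    simp only [pairing, Finset.smul_sum, map_smul, RingHom.id_apply]
    exact Finset.sum_congr rfl fun α _ => smul_comm _ _ _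

theorem pairingHom_apply {h : ℕ} {R : Type*} [CommRing R] [Algebra ℂ R]
    (q : MvPolynomial (Fin h) ℂ) (F : MvPowerSeries (Fin h) R) : pairingHom q F = pairing q F :=
  rfl

theorem pairing_congr {h : ℕ} {R : Type*} [CommRing R] [Algebra ℂ R]
    {q : MvPolynomial (Fin h) ℂ} {F G : MvPowerSeries (Fin h) R}
    (H : ∀ α ∈ q.support, MvPowerSeries.coeff α F = MvPowerSeries.coeff α G) :
    pairing q F = pairing q G :=
  Finset.sum_congr rfl fun α hα => by rw [H α hα]

theorem map_pairing {h : ℕ} {R S : Type*} [CommRing R] [Algebra ℂ R] [CommRing S] [Algebra ℂ S]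
    (f : R →ₐ[ℂ] S) (q : MvPolynomial (Fin h) ℂ) (F : MvPowerSeries (Fin h) R) :
    pairing q (MvPowerSeries.map (f : R →+* S) F) = f (pairing q F) := by
  simp [pairing, map_sum]

theorem factorial_prod_ne_zero {h : ℕ} (α : Fin h →₀ ℕ) :
    ((∏ k, (α k).factorial : ℕ) : ℂ) ≠ 0 := by
  exact_mod_cast Finset.prod_ne_zero_iff.mpr fun k _ => (α k).factorial_ne_zero

theorem pairing_monomial {h : ℕ} (q : MvPolynomial (Fin h) ℂ) (α : Fin h →₀ ℕ) :
    pairing q (MvPowerSeries.monomial α (1 : ℂ)) =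
      q.coeff α * ((∏ k, (α k).factorial : ℕ) : ℂ) := by
  classical
  simp only [pairing, MvPowerSeries.coeff_monomial, smul_eq_mul, mul_ite, mul_one, mul_zero]
  rw [Finset.sum_ite_eq']
  split_ifs with hα
  · rfl
  · rw [MvPolynomial.notMem_support_iff.mp hα, zero_mul]

/-- A functional that sees only the coefficients of `q` kills the whole ideal `(f)` as soon as
it kills all monomial multiples of `f`. -/
theorem pairing_mul_eq_zero {h : ℕ} {q : MvPolynomial (Fin h) ℂ} {f : MvPowerSeries (Fin h) ℂ}
    (H : ∀ α, pairing q (f * MvPowerSeries.monomial α (1 : ℂ)) = 0)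
    (g : MvPowerSeries (Fin h) ℂ) : pairing q (f * g) = 0 := by
  classical
  set S : Finset (Fin h →₀ ℕ) := q.support.biUnion fun β => Finset.Iic β with hS
  have h1 : pairing q (f * g) = pairing q (∑ α ∈ S, MvPowerSeries.coeff α g •
      (f * MvPowerSeries.monomial α (1 : ℂ))) := by
    refine pairing_congr fun β hβ => ?_
    have h2 : ∑ α ∈ S, MvPowerSeries.coeff α g • (f * MvPowerSeries.monomial α (1 : ℂ)) =
        f * ∑ α ∈ S, MvPowerSeries.monomial α (MvPowerSeries.coeff α g) := by
      rw [Finset.mul_sum]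
      refine Finset.sum_congr rfl fun α _ => ?_
      rw [← mul_smul_comm, ← map_smul, smul_eq_mul, mul_one]
    rw [h2, MvPowerSeries.coeff_mul, MvPowerSeries.coeff_mul]
    refine Finset.sum_congr rfl fun p hp => ?_
    congr 1
    rw [map_sum]
    simp only [MvPowerSeries.coeff_monomial]
    rw [Finset.sum_ite_eq, if_pos]
    refine Finset.mem_biUnion.mpr ⟨β, hβ, Finset.mem_Iic.mpr ?_⟩
    rw [← Finset.HasAntidiagonal.mem_antidiagonal.mp hp]
    exact le_add_self
  rw [h1, ← pairingHom_apply, map_sum]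
  refine Finset.sum_eq_zero fun α _ => ?_
  rw [map_smul, pairingHom_apply, H, smul_zero]

/-- The generic exponential `exp(∑_k s_k Y_k)` as a power series in `s` over `ℂ[Y]`. -/
def expUnit (h : ℕ) : MvPowerSeries (Fin h) (MvPolynomial (Fin h) ℂ) :=
  fun α => MvPolynomial.monomial α (((∏ k, (α k).factorial : ℕ) : ℂ)⁻¹)

/-- The contraction of `q` by `f`: the polynomial `(q(∂_s) • f(s) exp(∑_k s_k Y_k))|_{s=0}` in
`Y`, which is `f(∂_Y) • q(Y)`. -/
def contr {h : ℕ} (q : MvPolynomial (Fin h) ℂ) (f : MvPowerSeries (Fin h) ℂ) :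
    MvPolynomial (Fin h) ℂ :=
  pairing q (MvPowerSeries.map MvPolynomial.C f * expUnit h)

theorem coeff_contr {h : ℕ} (q : MvPolynomial (Fin h) ℂ) (f : MvPowerSeries (Fin h) ℂ)
    (α : Fin h →₀ ℕ) : (contr q f).coeff α =
      ((∏ k, (α k).factorial : ℕ) : ℂ)⁻¹ * pairing q (f * MvPowerSeries.monomial α (1 : ℂ)) := by
  classical
  simp only [contr, pairing, MvPolynomial.coeff_sum, MvPolynomial.coeff_smul, Finset.mul_sum]
  refine Finset.sum_congr rfl fun β _ => ?_
  rw [smul_eq_mul, smul_eq_mul, mul_left_comm]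
  congr 1
  rw [MvPowerSeries.coeff_mul, MvPowerSeries.coeff_mul, MvPolynomial.coeff_sum, Finset.mul_sum]
  refine Finset.sum_congr rfl fun p _ => ?_
  rw [MvPowerSeries.coeff_map, MvPolynomial.coeff_C_mul, MvPowerSeries.coeff_monomial]
  have : MvPowerSeries.coeff p.2 (expUnit h) =
    MvPolynomial.monomial p.2 (((∏ k, (p.2 k).factorial : ℕ) : ℂ)⁻¹) := rfl
  rw [this, MvPolynomial.coeff_monomial]
  split_ifs with h1
  · rw [h1]; ring
  · ring

theorem contr_one {h : ℕ} (q : MvPolynomial (Fin h) ℂ) : contr q 1 = q := by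
  ext α
  rw [coeff_contr, one_mul, pairing_monomial, mul_comm (q.coeff α), inv_mul_cancel_left₀]
  exact factorial_prod_ne_zero α

theorem contr_eq_zero_iff {h : ℕ} (q : MvPolynomial (Fin h) ℂ) (f : MvPowerSeries (Fin h) ℂ) :
    contr q f = 0 ↔ ∀ g, pairing q (f * g) = 0 := by
  refine ⟨fun H => pairing_mul_eq_zero fun α => ?_, fun H => ?_⟩
  · have := coeff_contr q f α
    rw [H, MvPolynomial.coeff_zero] at this
    exact (mul_eq_zero.mp this.symm).resolve_left (inv_ne_zero (factorial_prod_ne_zero α))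
  · ext α
    rw [coeff_contr, H, mul_zero, MvPolynomial.coeff_zero]

theorem pderiv_contr {h : ℕ} (q : MvPolynomial (Fin h) ℂ) (f : MvPowerSeries (Fin h) ℂ)
    (k : Fin h) : MvPolynomial.pderiv k (contr q f) = contr q (MvPowerSeries.X k * f) := by
  classical
  ext α
  rw [MvPolynomial.coeff_pderiv, coeff_contr, coeff_contr]
  have h1 : MvPowerSeries.X k * f * MvPowerSeries.monomial α (1 : ℂ) =
      f * MvPowerSeries.monomial (α + Finsupp.single k 1) (1 : ℂ) := by
    rw [MvPowerSeries.X, mul_comm _ f, mul_assoc, MvPowerSeries.monomial_mul_monomial, one_mul,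
      add_comm]
  have h2 : ∏ i, ((α + Finsupp.single k 1 : Fin h →₀ ℕ) i).factorial =
      (α k + 1) * ∏ i, (α i).factorial := by
    rw [← Finset.mul_prod_erase _ _ (Finset.mem_univ k),
      ← Finset.mul_prod_erase _ (fun i => (α i).factorial) (Finset.mem_univ k), ← mul_assoc]
    congr 1
    · simp [Nat.factorial_succ]
    · refine Finset.prod_congr rfl fun i hi => ?_
      simp [Finsupp.single_eq_of_ne (Finset.mem_erase.mp hi).1]
  have h3 := factorial_prod_ne_zero α
  have h4 : ((α k : ℂ) + 1) ≠ 0 := by exact_mod_cast (α k).succ_ne_zero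
  rw [h1, h2, Nat.cast_mul, Nat.cast_add_one]
  field_simp

/-! ### Polynomials in the logarithms of the torus coordinates -/

/-- The linear form `b^(k) · y` in `y = log x`. -/
def logForm {h n : ℕ} (b : Fin h → Fin n → ℤ) (k : Fin h) : MvPolynomial (Fin n) ℂ :=
  ∑ j, MvPolynomial.C (b k j : ℂ) * MvPolynomial.X j

/-- The polynomial `(q(∂_s) • f(s) x^(B s))|_{s=0}` in `y = log x`, linear in `f`. -/
def logTerm {h n : ℕ} (b : Fin h → Fin n → ℤ) (q : MvPolynomial (Fin h) ℂ) :
    MvPowerSeries (Fin h) ℂ →ₗ[ℂ] MvPolynomial (Fin n) ℂ where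
  toFun f := pairing q (MvPowerSeries.map MvPolynomial.C f * expForm b)
  map_add' f g := by
    rw [map_add, add_mul, ← pairingHom_apply, map_add]
    rfl
  map_smul' c f := by
    have : MvPowerSeries.map (MvPolynomial.C (σ := Fin n)) (c • f) =
        (MvPolynomial.C c : MvPolynomial (Fin n) ℂ) •
          MvPowerSeries.map (MvPolynomial.C (σ := Fin n)) f := by
      ext1 α
      simp
    rw [this, smul_mul_assoc, ← pairingHom_apply, map_smul, RingHom.id_apply, smul_eq_mul,
      MvPolynomial.smul_eq_C_mul]
    rfl

theorem logTerm_apply {h n : ℕ} (b : Fin h → Fin n → ℤ) (q : MvPolynomial (Fin h) ℂ)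
    (f : MvPowerSeries (Fin h) ℂ) :
    logTerm b q f = pairing q (MvPowerSeries.map MvPolynomial.C f * expForm b) := rfl

theorem logTerm_eq_aeval {h n : ℕ} (b : Fin h → Fin n → ℤ) (q : MvPolynomial (Fin h) ℂ)
    (f : MvPowerSeries (Fin h) ℂ) :
    logTerm b q f = MvPolynomial.aeval (logForm b) (contr q f) := by
  rw [contr, ← map_pairing, map_mul, logTerm_apply]
  congr 2
  · ext1 α
    simp
  · ext1 α
    rw [MvPowerSeries.coeff_map]
    change _ = (MvPolynomial.aeval (logForm b)) (MvPolynomial.monomial α _)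
    rw [MvPolynomial.aeval_monomial, Finsupp.prod_fintype _ _ fun i => pow_zero _]
    rfl

theorem pderiv_aeval_logForm {h n : ℕ} (b : Fin h → Fin n → ℤ) (p : MvPolynomial (Fin h) ℂ)
    (j : Fin n) : MvPolynomial.pderiv j (MvPolynomial.aeval (logForm b) p) =
      ∑ k, (b k j : ℂ) • MvPolynomial.aeval (logForm b) (MvPolynomial.pderiv k p) := by
  classical
  have hY : ∀ k, MvPolynomial.pderiv j (logForm b k) = MvPolynomial.C (b k j : ℂ) := by
    intro k
    simp only [logForm, map_sum, MvPolynomial.pderiv_C_mul, MvPolynomial.pderiv_X,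
      Pi.single_apply]
    simp
  induction p using MvPolynomial.induction_on with
  | C a => simp
  | add p q hp hq => simp only [map_add, hp, hq, smul_add, Finset.sum_add_distrib]
  | mul_X p i hp =>
    simp only [map_mul, MvPolynomial.aeval_X, MvPolynomial.pderiv_mul, hp, map_add, smul_add,
      Finset.sum_add_distrib, hY, MvPolynomial.pderiv_X, Pi.single_apply, Finset.sum_mul,
      smul_mul_assoc]
    congr 1
    simp [MvPolynomial.smul_eq_C_mul, mul_comm, apply_ite]

theorem pderiv_logTerm {h n : ℕ} (b : Fin h → Fin n → ℤ) (q : MvPolynomial (Fin h) ℂ)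
    (f : MvPowerSeries (Fin h) ℂ) (j : Fin n) :
    MvPolynomial.pderiv j (logTerm b q f) = logTerm b q (linForm b j * f) := by
  rw [logTerm_eq_aeval, pderiv_aeval_logForm, linForm, Finset.sum_mul, map_sum]
  refine Finset.sum_congr rfl fun k _ => ?_
  rw [pderiv_contr, ← logTerm_eq_aeval, mul_assoc, ← map_smul, MvPowerSeries.smul_eq_C_mul]

/-! ### Duality for homogeneous ideals -/

theorem homogeneousComponent_mul {h : ℕ} {f g : MvPowerSeries (Fin h) ℂ} {e : ℕ}
    (hg : g.IsHomogeneous e) (j : ℕ) : MvPowerSeries.homogeneousComponent j (f * g) =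
      if e ≤ j then MvPowerSeries.homogeneousComponent (j - e) f * g else 0 := by
  classical
  ext α
  rw [MvPowerSeries.coeff_homogeneousComponent]
  have key : ∀ p ∈ Finset.HasAntidiagonal.antidiagonal α, MvPowerSeries.coeff p.2 g ≠ 0 →
      α.degree = p.1.degree + e := by
    intro p hp h0
    rw [← Finset.HasAntidiagonal.mem_antidiagonal.mp hp, map_add]
    congr 1
    by_contra h1
    exact h0 (hg.coeff_eq_zero h1)
  split_ifs with h1 h2 h2
  · rw [MvPowerSeries.coeff_mul, MvPowerSeries.coeff_mul]
    refine Finset.sum_congr rfl fun p hp => ?_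
    by_cases h0 : MvPowerSeries.coeff p.2 g = 0
    · rw [h0, mul_zero, mul_zero]
    · rw [MvPowerSeries.coeff_homogeneousComponent, if_pos]
      have := key p hp h0
      omega
  · rw [MvPowerSeries.coeff_mul, map_zero]
    refine Finset.sum_eq_zero fun p hp => ?_
    by_contra h0
    have := key p hp (right_ne_zero_of_mul h0)
    omega
  · rw [MvPowerSeries.coeff_mul]
    refine (Finset.sum_eq_zero fun p hp => ?_).symm
    by_contra h0
    have := key p hp (right_ne_zero_of_mul h0)
    have h3 := left_ne_zero_of_mul h0
    rw [MvPowerSeries.coeff_homogeneousComponent] at h3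
    have := (ite_ne_right_iff.mp h3).1
    omega
  · rw [map_zero]

theorem homogeneousComponent_mem_span {h : ℕ} {S : Set (MvPowerSeries (Fin h) ℂ)}
    (hS : ∀ f ∈ S, ∃ e, f.IsHomogeneous e) {p : MvPowerSeries (Fin h) ℂ}
    (hp : p ∈ Ideal.span S) (j : ℕ) :
    MvPowerSeries.homogeneousComponent j p ∈ Ideal.span S := by
  suffices H : ∀ r : MvPowerSeries (Fin h) ℂ, ∀ j,
      MvPowerSeries.homogeneousComponent j (r * p) ∈ Ideal.span S by
    simpa using H 1 j
  refine Submodule.span_induction (p := fun p _ => ∀ r : MvPowerSeries (Fin h) ℂ, ∀ j,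
      MvPowerSeries.homogeneousComponent j (r * p) ∈ Ideal.span S) ?_ ?_ ?_ ?_ hp
  · intro f hf r j
    obtain ⟨e, he⟩ := hS f hf
    rw [homogeneousComponent_mul he]
    split_ifs
    · exact Ideal.mul_mem_left _ _ (Ideal.subset_span hf)
    · exact zero_mem _
  · intro r j
    simp
  · intro x y _ _ hx hy r j
    rw [mul_add, map_add]
    exact add_mem (hx r j) (hy r j)
  · intro a x _ hx r j
    rw [smul_eq_mul, ← mul_assoc]
    exact hx (r * a) j

theorem linForm_isHomogeneous {h n : ℕ} (b : Fin h → Fin n → ℤ) (i : Fin n) :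
    (linForm b i).IsHomogeneous 1 := by
  classical
  intro α hα
  rw [linForm, map_sum] at hα
  obtain ⟨k, -, hk⟩ := Finset.exists_ne_zero_of_sum_ne_zero hα
  rw [MvPowerSeries.coeff_C_mul, MvPowerSeries.coeff_X] at hk
  have := (ite_ne_right_iff.mp (right_ne_zero_of_mul hk)).1
  rw [this]
  simp [Finsupp.weight_apply]

theorem linProd_isHomogeneous {h n : ℕ} (b : Fin h → Fin n → ℤ) (I : Finset (Fin n)) :
    (linProd b I).IsHomogeneous I.card := by
  classical
  induction I using Finset.induction_on with
  | empty =>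
    intro α hα
    rw [linProd, Finset.prod_empty, MvPowerSeries.coeff_one] at hα
    simp [(ite_ne_right_iff.mp hα).1]
  | insert i I hi ih =>
    rw [linProd, Finset.prod_insert hi, Finset.card_insert_of_notMem hi, add_comm]
    exact MvPowerSeries.IsHomogeneous.mul (linForm_isHomogeneous b i) ih

/-- Inverse systems of colon ideals: if `Q` annihilates `P : m`, then `Q` is the contraction by
`m` of some `q ∈ P^⊥`. Homogeneity of `P` and `m` makes the functional
`m g + p ↦ ⟨Q, g⟩` well defined modulo all terms of high degree, so that an extension of it to
`ℂ[[s]]` is again given by a polynomial. -/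
theorem exists_mem_perp_of_colon {h : ℕ} {P : Ideal (MvPowerSeries (Fin h) ℂ)}
    (hPh : ∀ p ∈ P, ∀ j, MvPowerSeries.homogeneousComponent j p ∈ P)
    {m : MvPowerSeries (Fin h) ℂ} {e : ℕ} (hm : m.IsHomogeneous e)
    {Q : MvPolynomial (Fin h) ℂ} (hQ : ∀ g, g * m ∈ P → pairing Q g = 0) :
    ∃ q ∈ perp P, ∀ g, pairing q (m * g) = pairing Q g := by
  classical
  obtain ⟨D, hD⟩ : ∃ D, ∀ α ∈ Q.support, α.degree < D :=
    ⟨Q.support.sup Finsupp.degree + 1, fun α hα => Nat.lt_succ_of_le (Finset.le_sup hα)⟩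
  -- Terms of degree at least `D` do not meet `Q`; multiplication by `m` raises degrees by `e`.
  let H : Submodule ℂ (MvPowerSeries (Fin h) ℂ) :=
    ⨅ α : {α : Fin h →₀ ℕ // α.degree < D + e}, LinearMap.ker (MvPowerSeries.coeff (R := ℂ) α.1)
  have hH : ∀ F, F ∈ H ↔ ∀ α : Fin h →₀ ℕ, α.degree < D + e →
      MvPowerSeries.coeff α F = 0 := by
    intro F
    simp [H, Submodule.mem_iInf]
  let W : Submodule ℂ (MvPowerSeries (Fin h) ℂ) := P.restrictScalars ℂ ⊔ H
  let T := W.mkQ ∘ₗ LinearMap.mulLeft ℂ m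
  have hT : pairingHom Q ∈ (LinearMap.ker T).dualAnnihilator := by
    rw [Submodule.mem_dualAnnihilator]
    intro g hg
    have hg' : m * g ∈ W := by simpa [T] using hg
    obtain ⟨p, hp, t, ht, hpt⟩ := Submodule.mem_sup.mp hg'
    have hp' : p ∈ P := hp
    rw [hH] at ht
    have h1 : ∀ i < D, pairing Q (MvPowerSeries.homogeneousComponent i g) = 0 := by
      intro i hi
      refine hQ _ ?_
      have h2 := homogeneousComponent_mul (f := g) hm (i + e)
      rw [if_pos (Nat.le_add_left e i), Nat.add_sub_cancel, mul_comm g, ← hpt, map_add] at h2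
      have h3 : MvPowerSeries.homogeneousComponent (i + e) t = 0 := by
        ext α
        rw [MvPowerSeries.coeff_homogeneousComponent, map_zero]
        split_ifs with h4
        · exact ht α (by omega)
        · rfl
      rw [h3, add_zero] at h2
      rw [← h2]
      exact hPh p hp' _
    have h5 : pairing Q g =
        pairing Q (∑ i ∈ Finset.range D, MvPowerSeries.homogeneousComponent i g) := by
      refine pairing_congr fun α hα => ?_
      simp only [map_sum, MvPowerSeries.coeff_homogeneousComponent]
      rw [Finset.sum_ite_eq, if_pos (Finset.mem_range.mpr (hD α hα))]
    rw [pairingHom_apply, h5, ← pairingHom_apply, map_sum]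
    exact Finset.sum_eq_zero fun i hi => h1 i (Finset.mem_range.mp hi)
  rw [← LinearMap.range_dualMap_eq_dualAnnihilator_ker] at hT
  obtain ⟨l, hl⟩ := hT
  let S : Finset (Fin h →₀ ℕ) := (Finsupp.finite_of_degree_lt (σ := Fin h) (D + e)).toFinset
  have hS : ∀ α : Fin h →₀ ℕ, α ∈ S ↔ α.degree < D + e := by
    intro α
    simp [S]
  let μ : MvPowerSeries (Fin h) ℂ →ₗ[ℂ] ℂ := l ∘ₗ W.mkQ
  have hμ : ∀ F ∈ W, μ F = 0 := by
    intro F hF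
    simp [μ, (Submodule.Quotient.mk_eq_zero W).mpr hF]
  let q : MvPolynomial (Fin h) ℂ := ∑ α ∈ S, MvPolynomial.monomial α
    (μ (MvPowerSeries.monomial α 1) * ((∏ k, (α k).factorial : ℕ) : ℂ)⁻¹)
  have hqc : ∀ α, q.coeff α = if α ∈ S then
      μ (MvPowerSeries.monomial α 1) * ((∏ k, (α k).factorial : ℕ) : ℂ)⁻¹ else 0 := by
    intro α
    simp only [q, MvPolynomial.coeff_sum, MvPolynomial.coeff_monomial]
    rw [Finset.sum_ite_eq']
  have hq : ∀ F, pairing q F = μ F := by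
    intro F
    have h1 : μ F = μ (∑ α ∈ S, MvPowerSeries.monomial α (MvPowerSeries.coeff α F)) := by
      rw [← sub_eq_zero, ← map_sub]
      refine hμ _ (Submodule.mem_sup_right ((hH _).mpr fun α hα => ?_))
      simp only [map_sub, map_sum, MvPowerSeries.coeff_monomial]
      rw [Finset.sum_ite_eq, if_pos ((hS α).mpr hα), sub_self]
    have h2 : pairing q F = ∑ α ∈ S, (q.coeff α * ((∏ k, (α k).factorial : ℕ) : ℂ)) •
        MvPowerSeries.coeff α F := by
      refine Finset.sum_subset (fun α hα => ?_) fun α _ hα => ?_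
      · by_contra h3
        rw [MvPolynomial.mem_support_iff, hqc, if_neg h3] at hα
        exact hα rfl
      · rw [MvPolynomial.notMem_support_iff.mp hα, zero_mul, zero_smul]
    rw [h1, h2, map_sum]
    refine Finset.sum_congr rfl fun α hα => ?_
    rw [hqc, if_pos hα, inv_mul_cancel_right₀ (factorial_prod_ne_zero α), smul_eq_mul, mul_comm,
      ← smul_eq_mul, ← map_smul, ← map_smul, smul_eq_mul, mul_one]
  refine ⟨q, fun p hp => ?_, fun g => ?_⟩
  · rw [hq]
    exact hμ p (Submodule.mem_sup_left hp)
  · rw [hq, ← pairingHom_apply Q, ← hl]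
    rfl

/-! ### Differential operators on logarithmic series -/

theorem derivX_apply {n : ℕ} (j : Fin n) (φ : LogSeries n) (z : Fin n → ℂ) :
    derivX j φ z = MvPolynomial.pderiv j (φ (z + Pi.single j (1 : ℂ))) +
      (z j + 1) • φ (z + Pi.single j (1 : ℂ)) := rfl

theorem derivX_eq_logTerm {h n : ℕ} {b : Fin h → Fin n → ℤ} {q : MvPolynomial (Fin h) ℂ}
    {f : MvPowerSeries (Fin h) ℂ} {j : Fin n} {φ : LogSeries n} {z : Fin n → ℂ}
    (hφ : φ (z + Pi.single j (1 : ℂ)) = logTerm b q f) :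
    derivX j φ z = logTerm b q ((MvPowerSeries.C (z j + 1) + linForm b j) * f) := by
  rw [derivX_apply, hφ, pderiv_logTerm, add_mul, map_add, ← MvPowerSeries.smul_eq_C_mul, map_smul,
    add_comm]

theorem derivX_pow_eq_logTerm {h n : ℕ} {b : Fin h → Fin n → ℤ} {q : MvPolynomial (Fin h) ℂ}
    {j : Fin n} (k : ℕ) : ∀ {f : MvPowerSeries (Fin h) ℂ} {φ : LogSeries n} {z : Fin n → ℂ},
    φ (z + Pi.single j (k : ℂ)) = logTerm b q f →
    (derivX j ^ k) φ z = logTerm b q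
      ((∏ l ∈ Finset.range k, (MvPowerSeries.C (z j + k) + linForm b j - (l : MvPowerSeries _ ℂ)))
        * f) := by
  induction k with
  | zero =>
    intro f φ z hφ
    simpa using hφ
  | succ k ih =>
    intro f φ z hφ
    rw [pow_succ, Module.End.mul_apply]
    have h1 : derivX j φ (z + Pi.single j (k : ℂ)) =
        logTerm b q ((MvPowerSeries.C (z j + k + 1) + linForm b j) * f) := by
      have h2 : z j + k + 1 = (z + Pi.single j (k : ℂ) : Fin n → ℂ) j + 1 := by simp
      rw [h2]
      refine derivX_eq_logTerm ?_
      rw [add_assoc, ← Pi.single_add, ← hφ, Nat.cast_add_one]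
    have h3 : (∏ l ∈ Finset.range k,
          (MvPowerSeries.C (z j + k) + linForm b j - (l : MvPowerSeries (Fin h) ℂ))) =
        ∏ l ∈ Finset.range k, (MvPowerSeries.C (z j + (k + 1 : ℕ)) + linForm b j -
          ((l + 1 : ℕ) : MvPowerSeries (Fin h) ℂ)) := by
      refine Finset.prod_congr rfl fun l _ => ?_
      push_cast
      simp only [map_add, map_one]
      ring
    rw [ih h1, Finset.prod_range_succ', h3, ← mul_assoc, Nat.cast_zero, sub_zero, Nat.cast_add_one,
      add_assoc]

theorem derivMonomial_list_eq_logTerm {h n : ℕ} {b : Fin h → Fin n → ℤ}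
    {q : MvPolynomial (Fin h) ℂ} {a : Fin n →₀ ℕ} {f : MvPowerSeries (Fin h) ℂ} {φ : LogSeries n}
    {p : Fin n → ℂ} (hφ : φ p = logTerm b q f) (l : List (Fin n)) : ∀ {z : Fin n → ℂ}, l.Nodup →
    (∀ j ∈ l, p j = z j + a j) → (∀ j ∉ l, p j = z j) →
    (l.map fun j => derivX j ^ a j).prod φ z = logTerm b q
      ((l.map fun j => ∏ k ∈ Finset.range (a j),
        (perturbed b p j - (k : MvPowerSeries _ ℂ))).prod * f) := by
  induction l with
  | nil =>
    intro z _ _ h2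
    have : z = p := funext fun j => (h2 j (by simp)).symm
    simpa [this] using hφ
  | cons j l ih =>
    intro z hl h1 h2
    rw [List.nodup_cons] at hl
    rw [List.map_cons, List.prod_cons, Module.End.mul_apply, List.map_cons, List.prod_cons]
    have h3 := ih (z := z + Pi.single j (a j : ℂ)) hl.2 (fun i hi => by
      have hij : i ≠ j := fun e => hl.1 (e ▸ hi)
      rw [h1 i (List.mem_cons_of_mem _ hi), Pi.add_apply, Pi.single_eq_of_ne hij, add_zero])
      (fun i hi => by
        by_cases hij : i = j
        · subst hij
          rw [h1 i List.mem_cons_self, Pi.add_apply, Pi.single_eq_same]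
        · rw [h2 i (by simp [hij, hi]), Pi.add_apply, Pi.single_eq_of_ne hij, add_zero])
    rw [derivX_pow_eq_logTerm _ h3, mul_assoc, perturbed, h1 j List.mem_cons_self]

/-- The coefficient of `∂^a φ` at `x^z` depends only on that of `φ` at `x^(z + a)`, and
`∂^a` multiplies the symbol by `[p + B s]_a` with `p = z + a`. -/
theorem derivMonomial_eq_logTerm {h n : ℕ} {b : Fin h → Fin n → ℤ}
    {q : MvPolynomial (Fin h) ℂ} {a : Fin n →₀ ℕ} {f : MvPowerSeries (Fin h) ℂ} {φ : LogSeries n}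
    {p z : Fin n → ℂ} (hφ : φ p = logTerm b q f) (hp : ∀ j, p j = z j + a j) :
    derivMonomial a φ z = logTerm b q (falling (perturbed b p) a * f) := by
  rw [derivMonomial, derivMonomial_list_eq_logTerm hφ _ (List.nodup_finRange n)
    (fun j _ => hp j) (fun j hj => absurd (List.mem_finRange j) hj), falling, Fin.prod_univ_def]

theorem eulerOp_apply {d n : ℕ} (A : Matrix (Fin d) (Fin n) ℤ) (β : Fin d → ℂ) (i : Fin d)
    (φ : LogSeries n) (z : Fin n → ℂ) : eulerOp A β i φ z =
      ∑ j, (A i j : ℂ) • MvPolynomial.pderiv j (φ z) +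
        (∑ j, (A i j : ℂ) * z j - β i) • φ z := by
  have h1 : ∀ j, (mulX j * derivX j) φ z = MvPolynomial.pderiv j (φ z) + z j • φ z := by
    intro j
    have h2 : (mulX j * derivX j) φ z = derivX j φ (z - Pi.single j (1 : ℂ)) := rfl
    rw [h2, derivX_apply, sub_add_cancel, Pi.sub_apply, Pi.single_eq_same, sub_add_cancel]
  rw [eulerOp, LinearMap.sub_apply, Pi.sub_apply, LinearMap.sum_apply, Finset.sum_apply]
  simp only [LinearMap.smul_apply, Pi.smul_apply, h1, smul_add, Finset.sum_add_distrib,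
    Module.End.one_apply]
  rw [sub_smul, Finset.sum_smul]
  simp only [smul_smul]
  abel

theorem diffOp_eq_sum {n : ℕ} {p : MvPolynomial (Fin n) ℂ} {S : Finset (Fin n →₀ ℕ)}
    (hS : p.support ⊆ S) : diffOp p = ∑ a ∈ S, p.coeff a • derivMonomial a :=
  Finset.sum_subset hS fun a _ ha => by
    rw [MvPolynomial.notMem_support_iff.mp ha, zero_smul]

/-- The assignment `p ↦ p(∂)` as a linear map. -/
def diffOpHom (n : ℕ) : MvPolynomial (Fin n) ℂ →ₗ[ℂ] Module.End ℂ (LogSeries n) where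
  toFun := diffOp
  map_add' p q := by
    classical
    rw [diffOp_eq_sum (p := p) (Finset.subset_union_left (s₂ := q.support)),
      diffOp_eq_sum (p := q) (Finset.subset_union_right (s₁ := p.support)),
      diffOp_eq_sum MvPolynomial.support_add, ← Finset.sum_add_distrib]
    simp only [MvPolynomial.coeff_add, add_smul]
  map_smul' c p := by
    rw [diffOp_eq_sum (MvPolynomial.support_smul (a := c) (f := p)), diffOp, Finset.smul_sum]
    simp only [MvPolynomial.coeff_smul, smul_eq_mul, mul_smul, RingHom.id_apply]

theorem diffOp_monomial {n : ℕ} (a : Fin n →₀ ℕ) :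
    diffOp (MvPolynomial.monomial a (1 : ℂ)) = derivMonomial a := by
  classical
  rw [diffOp_eq_sum MvPolynomial.support_monomial_subset, Finset.sum_singleton,
    MvPolynomial.coeff_monomial, if_pos rfl, one_smul]

/-- The binomials of the toric ideal are stable under multiplication by monomials, so that they
span it linearly; being annihilated by the ideal is being annihilated by the binomials. -/
theorem toricIdeal_annihilates_iff {d n : ℕ} {A : Matrix (Fin d) (Fin n) ℤ} {φ : LogSeries n} :
    (∀ p ∈ toricIdeal A, diffOp p φ = 0) ↔ ∀ a a' : Fin n →₀ ℕ,
      (∀ i, ∑ j, A i j * (a j : ℤ) = ∑ j, A i j * (a' j : ℤ)) →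
      derivMonomial a φ = derivMonomial a' φ := by
  have hbin : ∀ a a' : Fin n →₀ ℕ,
      diffOp (MvPolynomial.monomial a (1 : ℂ) - MvPolynomial.monomial a' 1) φ =
        derivMonomial a φ - derivMonomial a' φ := by
    intro a a'
    have := map_sub (diffOpHom n) (MvPolynomial.monomial a (1 : ℂ)) (MvPolynomial.monomial a' 1)
    change diffOp _ = diffOp _ - diffOp _ at this
    rw [this, diffOp_monomial, diffOp_monomial, LinearMap.sub_apply]
  refine ⟨fun H a a' haa => ?_, fun H p hp => ?_⟩
  · rw [← sub_eq_zero, ← hbin]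
    exact H _ (Ideal.subset_span ⟨a, a', haa, rfl⟩)
  · suffices H' : ∀ r : MvPolynomial (Fin n) ℂ, diffOp (r * p) φ = 0 by
      simpa using H' 1
    rw [toricIdeal] at hp
    refine Submodule.span_induction
      (p := fun p _ => ∀ r : MvPolynomial (Fin n) ℂ, diffOp (r * p) φ = 0) ?_ ?_ ?_ ?_ hp
    · rintro _ ⟨a, a', haa, rfl⟩ r
      induction r using MvPolynomial.induction_on' with
      | monomial c x =>
        have h1 : MvPolynomial.monomial c x *
            (MvPolynomial.monomial a (1 : ℂ) - MvPolynomial.monomial a' 1) =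
            x • (MvPolynomial.monomial (c + a) (1 : ℂ) - MvPolynomial.monomial (c + a') 1) := by
          rw [mul_sub, MvPolynomial.monomial_mul, MvPolynomial.monomial_mul, smul_sub,
            MvPolynomial.smul_monomial, MvPolynomial.smul_monomial, smul_eq_mul]
        have h2 : diffOp (x • (MvPolynomial.monomial (c + a) (1 : ℂ) -
            MvPolynomial.monomial (c + a') 1)) = x • diffOp (MvPolynomial.monomial (c + a) (1 : ℂ) -
            MvPolynomial.monomial (c + a') 1) := map_smul (diffOpHom n) _ _
        rw [h1, h2, LinearMap.smul_apply, hbin, H (c + a) (c + a'), sub_self, smul_zero]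
        intro i
        simp only [Finsupp.add_apply, Nat.cast_add, mul_add, Finset.sum_add_distrib, haa i]
      | add r s hr hs =>
        rw [add_mul]
        have := map_add (diffOpHom n)
          (r * (MvPolynomial.monomial a (1 : ℂ) - MvPolynomial.monomial a' 1))
          (s * (MvPolynomial.monomial a (1 : ℂ) - MvPolynomial.monomial a' 1))
        change diffOp _ = diffOp _ + diffOp _ at this
        rw [this, LinearMap.add_apply, hr, hs, add_zero]
    · intro r
      rw [mul_zero, show diffOp (0 : MvPolynomial (Fin n) ℂ) = 0 from map_zero (diffOpHom n)]
      rfl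
    · intro x y _ _ hx hy r
      rw [mul_add, show diffOp (r * x + r * y) = diffOp (r * x) + diffOp (r * y) from
        map_add (diffOpHom n) _ _, LinearMap.add_apply, hx, hy, add_zero]
    · intro s x _ hx r
      rw [smul_eq_mul, ← mul_assoc]
      exact hx (r * s)

/-! ### Negative supports and falling factorials -/

theorem mem_nsupp_congr {n : ℕ} {z z' : Fin n → ℂ} {i : Fin n} (H : z i = z' i) :
    i ∈ nsupp z ↔ i ∈ nsupp z' := by
  rw [mem_nsupp, mem_nsupp, H]

theorem mem_nsupp_of_eq_sub {n : ℕ} {z z' : Fin n → ℂ} {i : Fin n} {k : ℕ} (H : z' i = z i - k)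
    (hi : i ∈ nsupp z) : i ∈ nsupp z' := by
  rw [mem_nsupp] at hi ⊢
  obtain ⟨m, hm, hm'⟩ := hi
  exact ⟨m - k, by omega, by rw [H, hm']; push_cast; rfl⟩

theorem mem_nsupp_sub_sdiff_iff {n : ℕ} (z : Fin n → ℂ) (a : Fin n → ℕ) (i : Fin n) :
    i ∈ nsupp (fun j => z j - a j) \ nsupp z ↔ ∃ k < a i, z i = (k : ℂ) := by
  rw [Finset.mem_sdiff, mem_nsupp, mem_nsupp]
  constructor
  · rintro ⟨⟨m, hm, hm'⟩, h2⟩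
    have h3 : z i = ((m + a i : ℤ) : ℂ) := by
      push_cast
      linear_combination hm'
    have h4 : 0 ≤ m + a i := by
      by_contra h5
      exact h2 ⟨m + a i, by omega, h3⟩
    refine ⟨(m + a i).toNat, by omega, ?_⟩
    rw [h3]
    exact_mod_cast congrArg (Int.cast : ℤ → ℂ) (Int.toNat_of_nonneg h4).symm
  · rintro ⟨k, hk, hz⟩
    refine ⟨⟨(k : ℤ) - a i, by omega, by rw [hz]; push_cast; rfl⟩, ?_⟩
    rintro ⟨m, hm, hm'⟩
    rw [hz] at hm'
    have : (k : ℤ) = m := by exact_mod_cast hm'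
    omega

/-- The falling factorial `[z + B s]_a` is, up to a unit of `ℂ[[s]]`, the product of the
`(B s)_i` over the `i` at which `z` becomes a negative integer on passing to `z - a`. -/
theorem falling_perturbed_associated {h n : ℕ} (b : Fin h → Fin n → ℤ) (z : Fin n → ℂ)
    (a : Fin n → ℕ) :
    Associated (falling (perturbed b z) a) (linProd b (nsupp (fun j => z j - a j) \ nsupp z)) := by
  have hm : linProd b (nsupp (fun j => z j - a j) \ nsupp z) =
      ∏ i, if i ∈ nsupp (fun j => z j - a j) \ nsupp z then linForm b i else 1 := by
    rw [linProd, Finset.prod_ite_mem, Finset.univ_inter]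
  rw [hm, falling]
  refine Associated.prod _ _ _ fun i _ => ?_
  have hC : ∀ k : ℕ, (k : MvPowerSeries (Fin h) ℂ) = MvPowerSeries.C (k : ℂ) := fun k => by simp
  have hunit : ∀ k : ℕ, z i ≠ k → IsUnit (perturbed b z i - (k : MvPowerSeries (Fin h) ℂ)) := by
    intro k hk
    rw [MvPowerSeries.isUnit_iff_constantCoeff]
    refine isUnit_iff_ne_zero.mpr ?_
    simpa [perturbed, linForm, sub_eq_zero] using hk
  split_ifs with hi
  · obtain ⟨k, hk, hz⟩ := (mem_nsupp_sub_sdiff_iff z a i).mp hi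
    rw [← Finset.mul_prod_erase _ _ (Finset.mem_range.mpr hk)]
    have h4 : perturbed b z i - (k : MvPowerSeries (Fin h) ℂ) = linForm b i := by
      rw [perturbed, hz, hC, add_sub_cancel_left]
    rw [h4]
    refine associated_mul_unit_left _ _ (IsUnit.prod_iff.mpr fun x hx => hunit x fun hx0 => ?_)
    refine (Finset.mem_erase.mp hx).1 ?_
    exact_mod_cast hx0.symm.trans hz
  · refine associated_one_iff_isUnit.mpr (IsUnit.prod_iff.mpr fun k hk => hunit k fun hz => hi ?_)
    exact (mem_nsupp_sub_sdiff_iff z a i).mpr ⟨k, Finset.mem_range.mp hk, hz⟩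

theorem nsupp_sub_posPart_sdiff {n : ℕ} (v : Fin n → ℂ) (u : Fin n → ℤ) :
    nsupp (fun j => shift v u j - ((u j).toNat : ℕ)) \ nsupp (shift v u) =
      nsupp v \ nsupp (shift v u) := by
  ext i
  simp only [Finset.mem_sdiff]
  refine and_congr_left fun hi => ?_
  rcases le_total 0 (u i) with h0 | h0
  · refine mem_nsupp_congr ?_
    have : ((u i).toNat : ℂ) = (u i : ℂ) := by
      exact_mod_cast congrArg (Int.cast : ℤ → ℂ) (Int.toNat_of_nonneg h0)
    rw [this, shift, add_sub_cancel_right]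
  · refine ⟨fun h1 => absurd ((mem_nsupp_congr ?_).mp h1) hi, fun h1 => absurd ?_ hi⟩
    · simp [Int.toNat_of_nonpos h0]
    · refine mem_nsupp_of_eq_sub (k := (-u i).toNat) ?_ h1
      have : ((-u i).toNat : ℂ) = ((-u i : ℤ) : ℂ) := by
        exact_mod_cast congrArg (Int.cast : ℤ → ℂ) (Int.toNat_of_nonneg (by omega : 0 ≤ -u i))
      rw [this, shift]
      push_cast
      ring

theorem nsupp_sub_negPart_sdiff {n : ℕ} (v : Fin n → ℂ) (u : Fin n → ℤ) :
    nsupp (fun j => v j - ((-u j).toNat : ℕ)) \ nsupp v = nsupp (shift v u) \ nsupp v := by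
  have := nsupp_sub_posPart_sdiff (shift v u) (-u)
  have h2 : shift (shift v u) (-u) = v := by
    funext i
    simp [shift]
  rwa [h2] at this

/-- The cocycle relation `[x+u]_a [x]_{u₋} [x+u']_{u'₊} = [x+u']_{a'} [x]_{u'₋} [x+u]_{u₊}` for
`u - a = u' - a'`; formally both sides are a quotient of Gamma functions. -/
theorem fallingFactor_cocycle {R : Type*} [CommRing R] (x : R) {u u' : ℤ} {a a' : ℕ}
    (H : u - a = u' - a') :
    (∏ l ∈ Finset.range a, (x + (u : R) - (l : R))) *
        (∏ l ∈ Finset.range (-u).toNat, (x - (l : R))) *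
        ∏ l ∈ Finset.range u'.toNat, (x + (u' : R) - (l : R)) =
      (∏ l ∈ Finset.range a', (x + (u' : R) - (l : R))) *
        (∏ l ∈ Finset.range (-u').toNat, (x - (l : R))) *
        ∏ l ∈ Finset.range u.toNat, (x + (u : R) - (l : R)) := by
  -- It suffices to treat the indeterminate over `ℤ`, where cancellation is available.
  let X : Polynomial ℤ := Polynomial.X
  let F (m : ℤ) (k : ℕ) : Polynomial ℤ := ∏ l ∈ Finset.range k, (X + (m : Polynomial ℤ) - l)
  suffices key : F u a * F 0 (-u).toNat * F u' u'.toNat =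
      F u' a' * F 0 (-u').toNat * F u u.toNat by
    have hc : ∀ m : ℤ, Polynomial.eval₂ (Int.castRingHom R) x (m : Polynomial ℤ) = (m : R) :=
      fun m => by
        rw [← Polynomial.coe_eval₂RingHom, map_intCast]
    have := congrArg (Polynomial.eval₂ (Int.castRingHom R) x) key
    simpa [F, X, Polynomial.eval₂_mul, Polynomial.eval₂_finsetProd, Polynomial.eval₂_sub,
      Polynomial.eval₂_add, hc] using this
  -- `F m k` is `Γ(X+m+1) / Γ(X+m-k+1)`, and `G m` plays the part of `Γ(X+m+1)`: falling factorials
  -- that all end at the same point `X - M + 1`, with `M` beyond every argument that occurs.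
  let M : ℤ := |u| + |u'| + a + a'
  let G (m : ℤ) : Polynomial ℤ := F m (m + M).toNat
  have hG0 : ∀ m, G m ≠ 0 := by
    intro m
    refine Finset.prod_ne_zero_iff.mpr fun l _ => ?_
    have : X + (m : Polynomial ℤ) - (l : Polynomial ℤ) = Polynomial.X + Polynomial.C (m - l) := by
      simp [X, add_sub_assoc]
    rw [this]
    exact Polynomial.X_add_C_ne_zero _
  have hFG : ∀ (m : ℤ) (k : ℕ) (m' : ℤ), m' = m - k → 0 ≤ m' + M → F m k * G m' = G m := by
    rintro m k _ rfl hm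
    have h1 : (m + M).toNat = k + (m - k + M).toNat := by omega
    simp only [G, F]
    rw [h1, Finset.prod_range_add]
    congr 1
    refine Finset.prod_congr rfl fun l _ => ?_
    push_cast
    ring
  have hM : M = |u| + |u'| + a + a' := rfl
  have b1 := neg_abs_le u
  have b2 := neg_abs_le u'
  have b3 := abs_nonneg u
  have b4 := abs_nonneg u'
  have e1 := hFG u a (u - a) rfl (by omega)
  have e2 := hFG 0 (-u).toNat (min u 0) (by omega)
    (by omega)
  have e3 := hFG u' u'.toNat (min u' 0) (by omega)
    (by omega)
  have e4 := hFG u' a' (u - a) H (by omega)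
  have e5 := hFG 0 (-u').toNat (min u' 0) (by omega)
    (by omega)
  have e6 := hFG u u.toNat (min u 0) (by omega)
    (by omega)
  refine mul_right_cancel₀ (mul_ne_zero (mul_ne_zero (hG0 (u - a)) (hG0 (min u 0)))
    (hG0 (min u' 0))) ?_
  calc _ = (F u a * G (u - a)) * (F 0 (-u).toNat * G (min u 0)) *
        (F u' u'.toNat * G (min u' 0)) := by ring
    _ = (F u' a' * G (u - a)) * (F 0 (-u').toNat * G (min u' 0)) *
        (F u u.toNat * G (min u 0)) := by rw [e1, e2, e3, e4, e5, e6]; ring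
    _ = _ := by ring

theorem falling_cocycle {h n : ℕ} (b : Fin h → Fin n → ℤ) (v : Fin n → ℂ) {u u' : Fin n → ℤ}
    {a a' : Fin n → ℕ} (H : ∀ i, u i - a i = u' i - a' i) :
    falling (perturbed b (shift v u)) a * falling (perturbed b v) (fun i => (-(u i)).toNat) *
        falling (perturbed b (shift v u')) (fun i => (u' i).toNat) =
      falling (perturbed b (shift v u')) a' * falling (perturbed b v) (fun i => (-(u' i)).toNat) *
        falling (perturbed b (shift v u)) (fun i => (u i).toNat) := by
  have hs : ∀ (u : Fin n → ℤ) i, perturbed b (shift v u) i =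
      perturbed b v i + (u i : MvPowerSeries (Fin h) ℂ) := by
    intro u i
    have : (u i : MvPowerSeries (Fin h) ℂ) = MvPowerSeries.C (u i : ℂ) := by simp
    rw [perturbed, perturbed, this, shift, map_add]
    ring
  simp only [falling, ← Finset.prod_mul_distrib, hs]
  exact Finset.prod_congr rfl fun i _ => fallingFactor_cocycle _ (H i)

/-! ### The perturbed series is hypergeometric -/

theorem mem_lattice_iff {d n : ℕ} {A : Matrix (Fin d) (Fin n) ℤ} {u : Fin n → ℤ} :
    u ∈ lattice A ↔ ∀ i, ∑ j, A i j * u j = 0 := by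
  rw [lattice, LinearMap.mem_ker, Matrix.mulVecLin_apply, funext_iff]
  rfl

theorem shift_injective {n : ℕ} (v : Fin n → ℂ) : Function.Injective (shift v) := by
  intro u u' H
  funext i
  have := congrFun H i
  simp only [shift, add_right_inj] at this
  exact_mod_cast this

theorem shift_zero {n : ℕ} (v : Fin n → ℂ) : shift v 0 = v := by
  funext i
  simp [shift]

theorem sum_mul_shift {d n : ℕ} {A : Matrix (Fin d) (Fin n) ℤ} {u : Fin n → ℤ}
    (hu : u ∈ lattice A) (v : Fin n → ℂ) (i : Fin d) :
    ∑ j, (A i j : ℂ) * shift v u j = ∑ j, (A i j : ℂ) * v j := by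
  have h1 : ∑ j, (A i j : ℂ) * (u j : ℂ) = 0 := by
    exact_mod_cast congrArg (Int.cast : ℤ → ℂ) (mem_lattice_iff.mp hu i)
  simp only [shift, mul_add, Finset.sum_add_distrib, h1, add_zero]

theorem sum_mul_linForm {d h n : ℕ} {A : Matrix (Fin d) (Fin n) ℤ} {b : Fin h → Fin n → ℤ}
    (hb : ∀ k, b k ∈ lattice A) (i : Fin d) :
    ∑ j, (A i j : ℂ) • linForm b j = 0 := by
  simp only [linForm, Finset.smul_sum]
  rw [Finset.sum_comm]
  refine Finset.sum_eq_zero fun k _ => ?_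
  have h1 : ∑ j, (A i j : ℂ) * (b k j : ℂ) = 0 := by
    exact_mod_cast congrArg (Int.cast : ℤ → ℂ) (mem_lattice_iff.mp (hb k) i)
  simp only [MvPowerSeries.smul_eq_C_mul, ← mul_assoc, ← map_mul]
  rw [← Finset.sum_mul, ← map_sum, h1, map_zero, zero_mul]

theorem logTerm_eq_zero_of_mem {h n : ℕ} (b : Fin h → Fin n → ℤ)
    {P : Ideal (MvPowerSeries (Fin h) ℂ)} {q : MvPolynomial (Fin h) ℂ} (hq : q ∈ perp P)
    {f : MvPowerSeries (Fin h) ℂ} (hf : f ∈ P) : logTerm b q f = 0 := by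
  rw [logTerm_eq_aeval, (contr_eq_zero_iff q f).mpr fun g => hq _ (P.mul_mem_right g hf), map_zero]

theorem linProd_dvd_linProd {h n : ℕ} (b : Fin h → Fin n → ℤ) {I J : Finset (Fin n)}
    (H : I ⊆ J) : linProd b I ∣ linProd b J :=
  Finset.prod_dvd_prod_of_subset _ _ _ H

theorem linProd_mul_linProd {h n : ℕ} (b : Fin h → Fin n → ℤ) {I J : Finset (Fin n)}
    (H : Disjoint I J) : linProd b I * linProd b J = linProd b (I ∪ J) :=
  (Finset.prod_union H).symm

theorem subset_of_KN {n : ℕ} {N : Set (Finset (Fin n))} {I : Finset (Fin n)} (hI : I ∈ N) :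
    KN N ⊆ I := by
  intro i hi
  simp only [KN, Finset.mem_filter, Finset.mem_univ, true_and] at hi
  exact hi I hI

/-- The coefficient `m_{v,N}(s) a_u(s)` vanishes on the hyperplanes `(B s)_i = 0` with
`i ∈ nsupp(v + u) \ K_N`: the factors of `m_{v,N}` with `i ∉ nsupp(v + u)` cancel the poles of
`a_u`, and the numerator of `a_u` contributes those with `i ∉ nsupp(v)`. -/
theorem linProd_dvd_frobCoeff {h n : ℕ} {b : Fin h → Fin n → ℤ} {v : Fin n → ℂ}
    {N : Set (Finset (Fin n))} {u : Fin n → ℤ} (hu : nsupp (shift v u) ∈ N)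
    (hub : u ∈ Submodule.span ℤ (Set.range b)) :
    linProd b (nsupp (shift v u) \ KN N) ∣ frobCoeff b v N u := by
  have hspec := frobCoeff_spec b v N u hu
  have hD := falling_perturbed_associated b (shift v u) fun i => (u i).toNat
  rw [nsupp_sub_posPart_sdiff] at hD
  have hD0 : linProd b (nsupp v \ nsupp (shift v u)) ≠ 0 :=
    hD.ne_zero_iff.mp (frobCoeff_denominator_ne_zero b v u hub)
  have hE := falling_perturbed_associated b v fun i => (-(u i)).toNat
  rw [nsupp_sub_negPart_sdiff] at hE
  have hKN := subset_of_KN hu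
  have hm : mN b v N = linProd b (nsupp v \ nsupp (shift v u)) *
      linProd b ((nsupp v ∩ nsupp (shift v u)) \ KN N) := by
    rw [mN, linProd_mul_linProd]
    · congr 1
      ext i
      have := @hKN i
      simp only [Finset.mem_sdiff, Finset.mem_union, Finset.mem_inter]
      tauto
    · rw [Finset.disjoint_left]
      intro i
      simp only [Finset.mem_sdiff, Finset.mem_inter]
      tauto
  have h1 : linProd b (nsupp (shift v u) \ KN N) ∣
      linProd b ((nsupp v ∩ nsupp (shift v u)) \ KN N) *
        linProd b (nsupp (shift v u) \ nsupp v) := by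
    rw [linProd_mul_linProd]
    · refine linProd_dvd_linProd b fun i => ?_
      simp only [Finset.mem_sdiff, Finset.mem_union, Finset.mem_inter]
      tauto
    · rw [Finset.disjoint_left]
      intro i
      simp only [Finset.mem_sdiff, Finset.mem_inter]
      tauto
  refine h1.trans ((mul_dvd_mul_iff_left hD0).mp ?_)
  rw [← mul_assoc, ← hm]
  calc mN b v N * linProd b (nsupp (shift v u) \ nsupp v)
      ∣ mN b v N * falling (perturbed b v) fun i => (-(u i)).toNat := mul_dvd_mul_left _ hE.symm.dvd
    _ = frobCoeff b v N u * falling (perturbed b (shift v u)) fun i => (u i).toNat := hspec.symm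
    _ ∣ frobCoeff b v N u * linProd b (nsupp v \ nsupp (shift v u)) := mul_dvd_mul_left _ hD.dvd
    _ = _ := mul_comm _ _

/-- If `∂^a` maps a term of the series to an exponent that would also be reached from outside the
support, then its symbol lies in `P_N`. -/
theorem falling_mul_frobCoeff_mem_PN {d h n : ℕ} {A : Matrix (Fin d) (Fin n) ℤ}
    {b : Fin h → Fin n → ℤ} {v : Fin n → ℂ} {N : Set (Finset (Fin n))} {u u' : Fin n → ℤ}
    (hub : u ∈ Submodule.span ℤ (Set.range b)) (hu' : u' ∈ lattice A)
    (hN : nsupp (shift v u) ∈ N) (hN' : nsupp (shift v u') ∉ N) {a a' : Fin n → ℕ}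
    (H : ∀ i, u i - a i = u' i - a' i) :
    falling (perturbed b (shift v u)) a * frobCoeff b v N u ∈ PN A b v N := by
  have h0 : linProd b ((nsupp (shift v u) ∪ nsupp (shift v u')) \ KN N) ∈ PN A b v N :=
    Ideal.subset_span ⟨_, hN, _, ⟨⟨u', hu', rfl⟩, hN'⟩, rfl⟩
  refine Ideal.mem_of_dvd _ ?_ h0
  refine dvd_trans ?_ (mul_dvd_mul (falling_perturbed_associated b (shift v u) a).symm.dvd
    (linProd_dvd_frobCoeff hN hub))
  rw [linProd_mul_linProd]
  · refine linProd_dvd_linProd b fun i => ?_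
    have h1 : i ∈ nsupp (shift v u') → i ∈ nsupp fun j => shift v u j - a j := by
      refine mem_nsupp_of_eq_sub (k := a' i) ?_
      have : (u i : ℂ) - a i = u' i - a' i := by exact_mod_cast congrArg (Int.cast : ℤ → ℂ) (H i)
      simp only [shift]
      linear_combination this
    simp only [Finset.mem_sdiff, Finset.mem_union]
    tauto
  · rw [Finset.disjoint_left]
    intro i
    simp only [Finset.mem_sdiff]
    tauto

theorem falling_mul_frobCoeff_eq {h n : ℕ} {b : Fin h → Fin n → ℤ} {v : Fin n → ℂ}
    {N : Set (Finset (Fin n))} {u u' : Fin n → ℤ}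
    (hub : u ∈ Submodule.span ℤ (Set.range b)) (hub' : u' ∈ Submodule.span ℤ (Set.range b))
    (hN : nsupp (shift v u) ∈ N) (hN' : nsupp (shift v u') ∈ N) {a a' : Fin n → ℕ}
    (H : ∀ i, u i - a i = u' i - a' i) :
    falling (perturbed b (shift v u)) a * frobCoeff b v N u =
      falling (perturbed b (shift v u')) a' * frobCoeff b v N u' := by
  refine mul_right_cancel₀ (mul_ne_zero (frobCoeff_denominator_ne_zero b v u hub)
    (frobCoeff_denominator_ne_zero b v u' hub')) ?_
  have h1 := frobCoeff_spec b v N u hN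
  have h2 := frobCoeff_spec b v N u' hN'
  have h3 := falling_cocycle b v H
  linear_combination (falling (perturbed b (shift v u)) a *
      falling (perturbed b (shift v u')) fun i => (u' i).toNat) * h1 -
    (falling (perturbed b (shift v u')) a' *
      falling (perturbed b (shift v u)) fun i => (u i).toNat) * h2 + mN b v N * h3

theorem frobSeries_shift {d h n : ℕ} {A : Matrix (Fin d) (Fin n) ℤ} (b : Fin h → Fin n → ℤ)
    (v : Fin n → ℂ) {N : Set (Finset (Fin n))} (q : MvPolynomial (Fin h) ℂ) {u : Fin n → ℤ}
    (hu : u ∈ lattice A) (hN : nsupp (shift v u) ∈ N) :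
    frobSeries A b v N q (shift v u) = logTerm b q (frobCoeff b v N u) := by
  have hz : ∃ u' ∈ lattice A, shift v u = shift v u' ∧ nsupp (shift v u') ∈ N :=
    ⟨u, hu, rfl, hN⟩
  rw [frobSeries, dif_pos hz, ← shift_injective v hz.choose_spec.2.1]
  rfl

theorem frobSeries_supportedIn {d h n : ℕ} (A : Matrix (Fin d) (Fin n) ℤ)
    (b : Fin h → Fin n → ℤ) (v : Fin n → ℂ) (N : Set (Finset (Fin n)))
    (q : MvPolynomial (Fin h) ℂ) : SupportedIn A v N (frobSeries A b v N q) := by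
  intro z hz
  by_contra H
  exact hz (dif_neg H)

theorem frobSeries_isHypergeometric {d h n : ℕ} {A : Matrix (Fin d) (Fin n) ℤ}
    {β : Fin d → ℂ} {b : Fin h → Fin n → ℤ} (hspan : Submodule.span ℤ (Set.range b) = lattice A)
    {v : Fin n → ℂ} (hv : ∀ i, ∑ j, (A i j : ℂ) * v j = β i) {N : Set (Finset (Fin n))}
    {q : MvPolynomial (Fin h) ℂ} (hq : q ∈ perp (PN A b v N)) :
    IsHypergeometric A β (frobSeries A b v N q) := by
  classical
  have hsupp := frobSeries_supportedIn A b v N q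
  have hb : ∀ k, b k ∈ lattice A := fun k => hspan ▸ Submodule.subset_span ⟨k, rfl⟩
  -- the symbol of the coefficient at `v + u`, extended by zero outside the support
  let F : (Fin n → ℤ) → MvPowerSeries (Fin h) ℂ :=
    fun u => if nsupp (shift v u) ∈ N then frobCoeff b v N u else 0
  have hF : ∀ u ∈ lattice A, frobSeries A b v N q (shift v u) = logTerm b q (F u) := by
    intro u hu
    by_cases hN : nsupp (shift v u) ∈ N
    · simp only [F, if_pos hN, frobSeries_shift b v q hu hN]
    · simp only [F, if_neg hN, map_zero]
      by_contra h0
      obtain ⟨u', _, h1, h2⟩ := hsupp _ h0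
      exact hN (h1 ▸ h2)
  have hF0 : ∀ z, (¬ ∃ u ∈ lattice A, z = shift v u) → frobSeries A b v N q z = 0 := by
    intro z hz
    by_contra h0
    obtain ⟨u, hu, h1, _⟩ := hsupp _ h0
    exact hz ⟨u, hu, h1⟩
  refine ⟨toricIdeal_annihilates_iff.mpr fun a a' haa => ?_, fun i => ?_⟩
  · funext z
    have hmem : (fun j => (a' j : ℤ) - a j) ∈ lattice A := by
      refine mem_lattice_iff.mpr fun i => ?_
      simp only [mul_sub, Finset.sum_sub_distrib, haa i, sub_self]
    by_cases hz : ∃ u ∈ lattice A, (fun j => z j + a j) = shift v u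
    · obtain ⟨u, hu, hzu⟩ := hz
      let u' : Fin n → ℤ := u + fun j => (a' j : ℤ) - a j
      have hu' : u' ∈ lattice A := add_mem hu hmem
      have H : ∀ i, u i - a i = u' i - a' i := by
        intro i
        simp only [u', Pi.add_apply]
        ring
      have hp : ∀ j, shift v u j = z j + a j := fun j => (congrFun hzu j).symm
      have hp' : ∀ j, shift v u' j = z j + a' j := by
        intro j
        have := hp j
        simp only [shift, u', Pi.add_apply, Int.cast_add, Int.cast_sub, Int.cast_natCast] at this ⊢
        linear_combination this
      rw [derivMonomial_eq_logTerm (hF u hu) hp, derivMonomial_eq_logTerm (hF u' hu') hp',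
        ← sub_eq_zero, ← map_sub]
      refine logTerm_eq_zero_of_mem b hq ?_
      by_cases hN : nsupp (shift v u) ∈ N <;> by_cases hN' : nsupp (shift v u') ∈ N
      · simp only [F, if_pos hN, if_pos hN']
        rw [falling_mul_frobCoeff_eq (hspan ▸ hu) (hspan ▸ hu') hN hN' H, sub_self]
        exact zero_mem _
      · simp only [F, if_pos hN, if_neg hN', mul_zero, sub_zero]
        exact falling_mul_frobCoeff_mem_PN (hspan ▸ hu) hu' hN hN' H
      · simp only [F, if_neg hN, if_pos hN', mul_zero, zero_sub]
        exact neg_mem (falling_mul_frobCoeff_mem_PN (hspan ▸ hu') hu hN' hN fun i => (H i).symm)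
      · simp only [F, if_neg hN, if_neg hN', mul_zero, sub_zero]
        exact zero_mem _
    · have hz' : ¬ ∃ u ∈ lattice A, (fun j => z j + a' j) = shift v u := by
        rintro ⟨u, hu, hzu⟩
        refine hz ⟨u - fun j => (a' j : ℤ) - a j, sub_mem hu hmem, ?_⟩
        funext j
        have := congrFun hzu j
        simp only [shift, Pi.sub_apply, Int.cast_sub, Int.cast_natCast] at this ⊢
        linear_combination this
      have h1 := hF0 _ hz
      have h2 := hF0 _ hz'
      rw [← map_zero (logTerm b q)] at h1 h2
      rw [derivMonomial_eq_logTerm h1 fun _ => rfl, derivMonomial_eq_logTerm h2 fun _ => rfl,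
        mul_zero, mul_zero]
  · funext z
    rw [eulerOp_apply]
    by_cases hz : ∃ u ∈ lattice A, z = shift v u
    · obtain ⟨u, hu, rfl⟩ := hz
      rw [sum_mul_shift hu, hv, sub_self, zero_smul, add_zero, hF u hu]
      simp only [pderiv_logTerm, ← map_smul, ← smul_mul_assoc]
      rw [← map_sum, ← Finset.sum_mul, sum_mul_linForm hb, zero_mul, map_zero]
      rfl
    · rw [hF0 z hz]
      simp

/-! ### The coefficient of the starting monomial -/

theorem finrank_span_rows {d n : ℕ} {A : Matrix (Fin d) (Fin n) ℤ}
    (hrank : (A.map (Int.cast : ℤ → ℚ)).rank = d) :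
    Module.finrank ℂ (Submodule.span ℂ (Set.range fun i j => (A i j : ℂ))) = d := by
  have h1 : LinearIndependent ℚ (A.map (Int.cast : ℤ → ℚ)).row := by
    rw [linearIndependent_iff_card_eq_finrank_span, Set.finrank, ← Matrix.rank_eq_finrank_span_row,
      hrank, Fintype.card_fin]
  have h2 := linearIndependent_algebraMap_comp_iff (S := ℂ).mpr h1
  have h3 : (fun i => algebraMap ℚ ℂ ∘ (A.map (Int.cast : ℤ → ℚ)).row i) =
      fun i j => (A i j : ℂ) := by
    funext i j
    simp
  rw [h3] at h2
  rw [finrank_span_eq_card h2, Fintype.card_fin]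

theorem linearIndependent_basis {d h n : ℕ} {A : Matrix (Fin d) (Fin n) ℤ}
    (B : Module.Basis (Fin h) ℤ (lattice A)) {b : Fin h → Fin n → ℤ}
    (hb : ∀ k, b k = (B k : Fin n → ℤ)) : LinearIndependent ℂ fun k j => (b k j : ℂ) := by
  have h1 : LinearIndependent ℤ b := by
    have := B.linearIndependent.map' (lattice A).subtype (Submodule.ker_subtype _)
    have h2 : b = (lattice A).subtype ∘ B := funext hb
    rwa [h2]
  have h2 := linearIndependent_algebraMap_comp_iff (S := ℂ).mpr h1
  have h3 : (fun i => algebraMap ℤ ℂ ∘ b i) = fun k j => (b k j : ℂ) := by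
    funext i j
    simp
  rwa [h3] at h2

theorem span_basis_eq {d h n : ℕ} {A : Matrix (Fin d) (Fin n) ℤ}
    (B : Module.Basis (Fin h) ℤ (lattice A)) {b : Fin h → Fin n → ℤ}
    (hb : ∀ k, b k = (B k : Fin n → ℤ)) : Submodule.span ℤ (Set.range b) = lattice A := by
  have h2 : b = (lattice A).subtype ∘ B := funext hb
  rw [h2, Set.range_comp, ← Submodule.map_span, B.span_eq, Submodule.map_top,
    Submodule.range_subtype]

/-- A vector orthogonal to the kernel of `A` is a combination of the rows of `A`. -/
theorem mem_span_rows {d n : ℕ} {A : Matrix (Fin d) (Fin n) ℤ}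
    (hrank : (A.map (Int.cast : ℤ → ℚ)).rank = d)
    (B : Module.Basis (Fin (n - d)) ℤ (lattice A)) {b : Fin (n - d) → Fin n → ℤ}
    (hb : ∀ k, b k = (B k : Fin n → ℤ)) {y : Fin n → ℂ}
    (hy : ∀ k, ∑ j, (b k j : ℂ) * y j = 0) :
    y ∈ Submodule.span ℂ (Set.range fun i j => (A i j : ℂ)) := by
  let M : Matrix (Fin (n - d)) (Fin n) ℂ := Matrix.of fun k j => (b k j : ℂ)
  have hM : M.rank = n - d := by
    have := (linearIndependent_basis B hb).rank_matrix (M := M)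
    rwa [Fintype.card_fin] at this
  have hdn : d ≤ n := hrank ▸ Matrix.rank_le_width _
  have hle : Submodule.span ℂ (Set.range fun i j => (A i j : ℂ)) ≤ LinearMap.ker M.mulVecLin := by
    rw [Submodule.span_le]
    rintro _ ⟨i, rfl⟩
    rw [SetLike.mem_coe, LinearMap.mem_ker, Matrix.mulVecLin_apply]
    funext k
    have hk : b k ∈ lattice A := hb k ▸ (B k).2
    have h1 : ∑ j, (A i j : ℂ) * (b k j : ℂ) = 0 := by
      exact_mod_cast congrArg (Int.cast : ℤ → ℂ) (mem_lattice_iff.mp hk i)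
    simpa [M, Matrix.mulVec, dotProduct, mul_comm] using h1
  have hfin : Module.finrank ℂ (LinearMap.ker M.mulVecLin) = d := by
    have := M.mulVecLin.finrank_range_add_finrank_ker
    rw [Module.finrank_fin_fun] at this
    have h2 : Module.finrank ℂ (LinearMap.range M.mulVecLin) = n - d := hM
    omega
  rw [Submodule.eq_of_le_of_finrank_eq hle ((finrank_span_rows hrank).trans hfin.symm)]
  rw [LinearMap.mem_ker, Matrix.mulVecLin_apply]
  funext k
  exact hy k

/-- A polynomial with vanishing derivative in the direction `a` is invariant under translation
by `a`. -/
theorem eval_add_of_directional_deriv_eq_zero {n : ℕ} {r : MvPolynomial (Fin n) ℂ}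
    {a : Fin n → ℂ} (ha : ∑ j, a j • MvPolynomial.pderiv j r = 0) (y : Fin n → ℂ) :
    MvPolynomial.eval (y + a) r = MvPolynomial.eval y r := by
  classical
  let γ : Fin n → Polynomial ℂ := fun j => Polynomial.C (y j) + Polynomial.C (a j) * Polynomial.X
  have hder : ∀ p : MvPolynomial (Fin n) ℂ, Polynomial.derivative (MvPolynomial.aeval γ p) =
      MvPolynomial.aeval γ (∑ j, a j • MvPolynomial.pderiv j p) := by
    intro p
    induction p using MvPolynomial.induction_on with
    | C c => simp
    | add p q hp hq => simp only [map_add, hp, hq, smul_add, Finset.sum_add_distrib]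
    | mul_X p i hp =>
      simp only [map_mul, MvPolynomial.aeval_X, Polynomial.derivative_mul, hp,
        MvPolynomial.pderiv_mul, smul_add, Finset.sum_add_distrib, map_add, map_sum, map_smul,
        MvPolynomial.pderiv_X, Pi.single_apply, Finset.sum_mul, smul_mul_assoc]
      congr 1
      have hγ : Polynomial.derivative (γ i) = Polynomial.C (a i) := by
        change Polynomial.derivative (Polynomial.C (y i) + Polynomial.C (a i) * Polynomial.X) = _
        rw [Polynomial.derivative_add, Polynomial.derivative_C, zero_add,
          Polynomial.derivative_C_mul, Polynomial.derivative_X, mul_one]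
      rw [hγ, Finset.sum_eq_single_of_mem i (Finset.mem_univ i)]
      · rw [if_pos rfl, map_one, mul_one, Polynomial.smul_eq_C_mul, mul_comm]
      · intro x _ hx
        rw [if_neg hx.symm, map_zero, mul_zero, smul_zero]
  have h0 := hder r
  rw [ha, map_zero] at h0
  have hev : ∀ t : ℂ, Polynomial.eval t (MvPolynomial.aeval γ r) =
      MvPolynomial.eval (y + t • a) r := by
    intro t
    rw [MvPolynomial.aeval_def, ← Polynomial.coe_evalRingHom, MvPolynomial.hom_eval₂]
    have h1 : (Polynomial.evalRingHom t).comp (algebraMap ℂ (Polynomial ℂ)) = RingHom.id ℂ :=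
      RingHom.ext fun c => Polynomial.eval_C
    rw [h1]
    change _ = MvPolynomial.eval₂ (RingHom.id ℂ) _ r
    congr 1
    funext j
    change Polynomial.eval t (Polynomial.C (y j) + Polynomial.C (a j) * Polynomial.X) =
      y j + t * a j
    rw [Polynomial.eval_add, Polynomial.eval_C, Polynomial.eval_mul, Polynomial.eval_C,
      Polynomial.eval_X, mul_comm]
  have h1 := hev 1
  have h2 := hev 0
  rw [one_smul] at h1
  rw [zero_smul, add_zero] at h2
  rw [← h1, ← h2, Polynomial.eq_C_of_derivative_eq_zero h0, Polynomial.eval_C, Polynomial.eval_C]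

theorem exists_dual_family {h n : ℕ} {b : Fin h → Fin n → ℤ}
    (hb : LinearIndependent ℂ fun k j => (b k j : ℂ)) :
    ∃ c : Fin h → Fin n → ℂ, ∀ k l, ∑ j, (b k j : ℂ) * c l j = if k = l then 1 else 0 := by
  classical
  let M : Matrix (Fin h) (Fin n) ℂ := Matrix.of fun k j => (b k j : ℂ)
  have hsurj : Function.Surjective M.mulVecLin := by
    rw [← LinearMap.range_eq_top]
    refine Submodule.eq_top_of_finrank_eq ?_
    have h1 : M.rank = Fintype.card (Fin h) := hb.rank_matrix (M := M)
    rw [Module.finrank_fintype_fun_eq_card]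
    exact h1
  choose c hc using fun l => hsurj (Pi.single l 1)
  refine ⟨c, fun k l => ?_⟩
  have := congrFun (hc l) k
  rw [Pi.single_apply] at this
  exact this

/-- The forms `b^(k) · y` are algebraically independent. -/
theorem aeval_logForm_injective {h n : ℕ} {b : Fin h → Fin n → ℤ}
    (hb : LinearIndependent ℂ fun k j => (b k j : ℂ)) :
    Function.Injective (MvPolynomial.aeval (R := ℂ) (logForm b)) := by
  obtain ⟨c, hc⟩ := exists_dual_family hb
  let g : MvPolynomial (Fin n) ℂ →ₐ[ℂ] MvPolynomial (Fin h) ℂ :=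
    MvPolynomial.aeval fun j => ∑ l, MvPolynomial.C (c l j) * MvPolynomial.X l
  refine Function.LeftInverse.injective (g := g) fun p => ?_
  have h1 : g.comp (MvPolynomial.aeval (logForm b)) = AlgHom.id ℂ _ := by
    refine MvPolynomial.algHom_ext fun k => ?_
    rw [AlgHom.comp_apply, MvPolynomial.aeval_X, logForm, map_sum, AlgHom.id_apply]
    simp only [map_mul, g, MvPolynomial.aeval_X, MvPolynomial.algHom_C,
      MvPolynomial.algebraMap_eq, Finset.mul_sum]
    rw [Finset.sum_comm]
    have h2 : ∀ l, ∑ j, MvPolynomial.C (b k j : ℂ) * (MvPolynomial.C (c l j) *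
        MvPolynomial.X l) = MvPolynomial.C (if k = l then (1 : ℂ) else 0) * MvPolynomial.X l := by
      intro l
      rw [← hc k l, map_sum, Finset.sum_mul]
      simp only [map_mul, mul_assoc]
    simp only [h2]
    simp
  exact DFunLike.congr_fun h1 p

/-- The polynomials in `log x` killed by the Euler operators are those in the `b^(k) · log x`. -/
theorem exists_eq_aeval_logForm {d n : ℕ} {A : Matrix (Fin d) (Fin n) ℤ}
    (hrank : (A.map (Int.cast : ℤ → ℚ)).rank = d)
    (B : Module.Basis (Fin (n - d)) ℤ (lattice A)) {b : Fin (n - d) → Fin n → ℤ}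
    (hb : ∀ k, b k = (B k : Fin n → ℤ)) {r : MvPolynomial (Fin n) ℂ}
    (hr : ∀ i, ∑ j, (A i j : ℂ) • MvPolynomial.pderiv j r = 0) :
    ∃ Q : MvPolynomial (Fin (n - d)) ℂ, MvPolynomial.aeval (logForm b) Q = r := by
  obtain ⟨c, hc⟩ := exists_dual_family (linearIndependent_basis B hb)
  refine ⟨MvPolynomial.aeval (fun j => ∑ l, MvPolynomial.C (c l j) * MvPolynomial.X l) r, ?_⟩
  refine MvPolynomial.funext fun y => ?_
  -- the projection of `y` to the span of the dual family along the row space of `A`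
  let y' : Fin n → ℂ := fun j => ∑ l, c l j * ∑ i, (b l i : ℂ) * y i
  have h1 : MvPolynomial.eval y (MvPolynomial.aeval (logForm b) (MvPolynomial.aeval
      (fun j => ∑ l, MvPolynomial.C (c l j) * MvPolynomial.X l) r)) = MvPolynomial.eval y' r := by
    have : ((MvPolynomial.aeval y).comp (MvPolynomial.aeval (logForm b))).comp
        (MvPolynomial.aeval (fun j => ∑ l, MvPolynomial.C (c l j) * MvPolynomial.X l)) =
        (MvPolynomial.aeval y' : MvPolynomial (Fin n) ℂ →ₐ[ℂ] ℂ) := by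
      refine MvPolynomial.algHom_ext fun j => ?_
      simp [logForm, y']
    exact DFunLike.congr_fun this r
  rw [h1]
  have h2 : y - y' ∈ Submodule.span ℂ (Set.range fun i j => (A i j : ℂ)) := by
    refine mem_span_rows hrank B hb fun k => ?_
    simp only [Pi.sub_apply, mul_sub, Finset.sum_sub_distrib, y', Finset.mul_sum]
    rw [sub_eq_zero]
    conv_rhs => rw [Finset.sum_comm]
    have h3 : ∀ l, ∑ j, ∑ i, (b k j : ℂ) * (c l j * ((b l i : ℂ) * y i)) =
        (if k = l then 1 else 0) * ∑ i, (b l i : ℂ) * y i := by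
      intro l
      rw [← hc k l, Finset.sum_mul]
      refine Finset.sum_congr rfl fun j _ => ?_
      rw [Finset.mul_sum]
      exact Finset.sum_congr rfl fun i _ => by ring
    simp only [h3]
    simp
  have h4 : ∀ a ∈ Submodule.span ℂ (Set.range fun i j => (A i j : ℂ)),
      ∑ j, a j • MvPolynomial.pderiv j r = 0 := by
    intro a ha
    refine Submodule.span_induction (p := fun a _ => ∑ j, a j • MvPolynomial.pderiv j r = 0)
      ?_ ?_ ?_ ?_ ha
    · rintro _ ⟨i, rfl⟩
      exact hr i
    · simp
    · intro x y _ _ hx hy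
      simp only [Pi.add_apply, add_smul, Finset.sum_add_distrib, hx, hy, add_zero]
    · intro t x _ hx
      simp only [Pi.smul_apply, smul_eq_mul, mul_smul, ← Finset.smul_sum, hx, smul_zero]
  have h5 := eval_add_of_directional_deriv_eq_zero (h4 _ h2) y'
  rw [add_sub_cancel] at h5
  exact h5.symm

/-- A vanishing coefficient at `v + u` forces the symbol of the coefficient at `v` to be
annihilated by `(B s)^(J \ nsupp(v))`, where `J = nsupp(v + u)`: compare `∂^(u₋)` and `∂^(u₊)`. -/
theorem pairing_linProd_mul_eq_zero {d h n : ℕ} {A : Matrix (Fin d) (Fin n) ℤ}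
    {b : Fin h → Fin n → ℤ} (hb : LinearIndependent ℂ fun k j => (b k j : ℂ)) {v : Fin n → ℂ}
    {φ : LogSeries n} (hφ : ∀ p ∈ toricIdeal A, diffOp p φ = 0) {Q : MvPolynomial (Fin h) ℂ}
    (hQ : φ v = logTerm b Q 1) {u : Fin n → ℤ} (hu : u ∈ lattice A) (h0 : φ (shift v u) = 0)
    (g : MvPowerSeries (Fin h) ℂ) :
    pairing Q (linProd b (nsupp (shift v u) \ nsupp v) * g) = 0 := by
  let a : Fin n →₀ ℕ := Finsupp.equivFunOnFinite.symm fun i => (-(u i)).toNat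
  let a' : Fin n →₀ ℕ := Finsupp.equivFunOnFinite.symm fun i => (u i).toNat
  have hsub : ∀ j, (a' j : ℤ) - a j = u j := by
    intro j
    simp only [a, a', Finsupp.equivFunOnFinite_symm_apply_apply]
    omega
  have haa : ∀ i, ∑ j, A i j * (a j : ℤ) = ∑ j, A i j * (a' j : ℤ) := by
    intro i
    rw [eq_comm, ← sub_eq_zero, ← Finset.sum_sub_distrib]
    simp only [← mul_sub, hsub]
    exact mem_lattice_iff.mp hu i
  have h1 := congrFun (toricIdeal_annihilates_iff.mp hφ a a' haa) fun j => v j - a j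
  rw [← map_zero (logTerm b Q)] at h0
  rw [derivMonomial_eq_logTerm hQ (fun j => by ring), derivMonomial_eq_logTerm h0 (fun j => by
    have : (a' j : ℂ) - a j = u j := by exact_mod_cast congrArg (Int.cast : ℤ → ℂ) (hsub j)
    simp only [shift]
    linear_combination -this), mul_zero, map_zero, mul_one, logTerm_eq_aeval] at h1
  have h2 := (contr_eq_zero_iff _ _).mp ((map_eq_zero_iff _ (aeval_logForm_injective hb)).mp h1)
  have hE := falling_perturbed_associated b v a
  have h3 : nsupp (fun j => v j - (a j : ℕ)) \ nsupp v = nsupp (shift v u) \ nsupp v :=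
    nsupp_sub_negPart_sdiff v u
  rw [h3] at hE
  obtain ⟨e, he⟩ := hE
  rw [← he, mul_assoc]
  exact h2 _

theorem perp_span_of_forall {h : ℕ} {S : Set (MvPowerSeries (Fin h) ℂ)}
    {Q : MvPolynomial (Fin h) ℂ} (H : ∀ f ∈ S, ∀ g, pairing Q (f * g) = 0) :
    Q ∈ perp (Ideal.span S) := by
  intro p hp
  suffices H' : ∀ g, pairing Q (p * g) = 0 by simpa using H' 1
  refine Submodule.span_induction (p := fun p _ => ∀ g, pairing Q (p * g) = 0) H ?_ ?_ ?_ hp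
  · intro g
    rw [zero_mul, ← pairingHom_apply, map_zero]
  · intro x y _ _ hx hy g
    rw [add_mul, ← pairingHom_apply, map_add, pairingHom_apply, pairingHom_apply, hx, hy, add_zero]
  · intro r x _ hx g
    rw [smul_eq_mul, mul_comm r, mul_assoc]
    exact hx _

theorem frobCoeff_zero {h n : ℕ} (b : Fin h → Fin n → ℤ) (v : Fin n → ℂ)
    {N : Set (Finset (Fin n))} (hN : nsupp v ∈ N) : frobCoeff b v N 0 = mN b v N := by
  have := frobCoeff_spec b v N 0 (by rwa [shift_zero])
  simpa [falling] using this

end AHyp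

end

theorem mainTheorem6 {d n : ℕ} (A : Matrix (Fin d) (Fin n) ℤ)
    (hrank : (A.map (Int.cast : ℤ → ℚ)).rank = d) (hhom : AHyp.IsHomogeneousMatrix A)
    (β : Fin d → ℂ) (w : Fin n → ℝ) (hw : AHyp.IsGenericWeight A w)
    (v₀ : Fin n → ℂ) (hv₀ : AHyp.IsFakeExponent A β w v₀)
    (v : Fin n → ℂ) (hv : ∃ u ∈ AHyp.lattice A, v = AHyp.shift v₀ u)
    (hmin : AHyp.IsMinimalWeight A w v)
    (B : Module.Basis (Fin (n - d)) ℤ (AHyp.lattice A))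
    (b : Fin (n - d) → Fin n → ℤ) (hb : ∀ k, b k = (B k : Fin n → ℤ))
    (N' N'' : Set (Finset (Fin n))) (hI₀ : AHyp.nsupp v ∈ N') (hN : N' ⊆ N'')
    (hNv : N'' ⊆ AHyp.Nv A w v)
    (hP : (AHyp.PN A b v N'').colon {AHyp.mN b v N''} = AHyp.PB A b v N'')
    (φ : AHyp.LogSeries n) (hφ : AHyp.IsHypergeometric A β φ)
    (hsupp : AHyp.SupportedIn A v N' φ) (hexp : AHyp.HasExponent A w v φ) :
    ∃ q ∈ AHyp.perp (AHyp.PN A b v N''),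
      AHyp.IsHypergeometric A β (AHyp.frobSeries A b v N'' q) ∧
      AHyp.SupportedIn A v N'' (AHyp.frobSeries A b v N'' q) ∧
      AHyp.HasExponent A w v (AHyp.frobSeries A b v N'' q) ∧
      AHyp.frobSeries A b v N'' q v = φ v := by
  open AHyp in
  have hvβ : ∀ i, ∑ j, (A i j : ℂ) * v j = β i := by
    obtain ⟨u, hu, rfl⟩ := hv
    intro i
    rw [sum_mul_shift hu]
    exact hv₀.1 i
  have hI₀' : nsupp v ∈ N'' := hN hI₀
  -- the coefficient of `x^v` in `φ` is a polynomial in the `b^(k) · log x`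
  obtain ⟨Q, hQ⟩ := exists_eq_aeval_logForm hrank B hb (r := φ v) fun i => by
    have := congrFun (hφ.2 i) v
    rw [eulerOp_apply, hvβ, sub_self, zero_smul, add_zero] at this
    exact this
  have hQ1 : φ v = logTerm b Q 1 := by rw [logTerm_eq_aeval, contr_one, hQ]
  have hQB : Q ∈ perp (PB A b v N'') := by
    refine perp_span_of_forall ?_
    rintro _ ⟨_, ⟨⟨u, hu, rfl⟩, hJ⟩, rfl⟩ g
    refine pairing_linProd_mul_eq_zero (linearIndependent_basis B hb) hφ.1 hQ1 hu ?_ g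
    by_contra h0
    obtain ⟨u', _, h1, h2⟩ := hsupp _ h0
    exact hJ (hN (h1 ▸ h2))
  obtain ⟨q, hq, hqm⟩ := exists_mem_perp_of_colon (P := PN A b v N'') (m := mN b v N'') (Q := Q)
    (fun p hp j => homogeneousComponent_mem_span (by
      rintro _ ⟨I, _, J, _, rfl⟩
      exact ⟨_, linProd_isHomogeneous b _⟩) hp j)
    (linProd_isHomogeneous b _) (fun g hg => hQB g (by
      rw [← hP, Submodule.mem_colon_singleton]
      exact hg))
  have hcoeff : frobSeries A b v N'' q v = φ v := by
    have h1 := frobSeries_shift b v q (zero_mem (lattice A)) (N := N'') (by rwa [shift_zero])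
    rw [shift_zero, frobCoeff_zero b v hI₀'] at h1
    rw [h1, hQ1, logTerm_eq_aeval, logTerm_eq_aeval]
    congr 1
    ext α
    rw [coeff_contr, coeff_contr, hqm, one_mul]
  have hs := frobSeries_supportedIn A b v N'' q
  -- the exponent condition holds because `N''` is contained in `N_v`
  refine ⟨q, hq, frobSeries_isHypergeometric (span_basis_eq B hb) hvβ hq, hs,
    ⟨hcoeff ▸ hexp.1, fun u hu h0 => ?_⟩, hcoeff⟩
  obtain ⟨u', _, h1, h2⟩ := hs _ h0
  exact (hNv (h1 ▸ h2)).2 u hu rfl
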